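/- Let $\hbar, m > 0$ and work in $L^2(\mathbb R_+)$, $\mathbb R_+ = (0,\infty)$. Let $H_D\psi = -\frac{\hbar^2}{2m}\psi''$ with domain $H^1_0(\mathbb R_+)\cap H^2(\mathbb R_+)$ (Dirichlet Laplacian) and $H_N\psi = -\frac{\hbar^2}{2m}\psi''$ with domain $\{\psi\in H^2(\mathbb R_+) : \psi'(0)=0\}$ (Neumann Laplacian). These operators generate strongly continuous one-parameter unitary groups $U^D_t = e^{-i\frac{t}{\hbar}H_D}$ and $U^N_t = e^{-i\frac{t}{\hbar}H_N}$, $t\in\mathbb R$. Let $\mathcal F_s,\mathcal F_c : L^2(\mathbb R_+)\to L^2(\mathbb R_+)$ be the Fourier-sine and Fourier-cosine transforms, i.e. the bounded operators given for $\psi\in L^1(\mathbb R_+)\cap L^2(\mathbb R_+)$ by $$(\mathcal F_s\psi)(k) = -\frac{2i}{\sqrt{2\pi}}\int_0^\infty \sin(kx)\,\psi(x)\,dx,\qquad (\mathcal F_c\psi)(k) = \frac{2}{\sqrt{2\pi}}\int_0^\infty \cos(kx)\,\psi(x)\,dx .$$ Then the wave operators for the pair (Dirichlet Laplacian, Neumann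 Laplacian), $$\Omega^{\pm}_{ND} := \operatorname*{s-lim}_{t\to\pm\infty} U^N_{-t}\,U^D_t ,$$ exist as strong limits on $L^2(\mathbb R_+)$ and $$\Omega^{\pm}_{ND} = \pm\,\mathcal F_c^*\,\mathcal F_s .$$ -/

import Mathlib

open MeasureTheory Set Filter Topology
open scoped ENNReal ContDiff FourierTransform

noncomputable section

namespace HalfLine

/-- The Hilbert space `L²(ℝ₊)` of complex-valued functions, `ℝ₊ = (0, ∞)`. -/
abbrev L2 : Type := Lp ℂ 2 (volume.restrict (Ioi (0 : ℝ)))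

/-- The Hilbert space `L²(ℝ)` of complex-valued functions. -/
abbrev L2Line : Type := Lp ℂ 2 (volume : Measure ℝ)

/-! ### Sobolev spaces on the half-line -/

/-- `φ` is a test function on `ℝ₊`: an element of `C₀^∞(ℝ₊)`, extended by zero. -/
structure IsTestFunction (φ : ℝ → ℂ) : Prop where
  smooth : ContDiff ℝ ∞ φ
  compactSupport : HasCompactSupport φ
  support_subset : tsupport φ ⊆ Ioi 0

/-- `g ∈ L²(ℝ₊)` is the weak derivative of `f ∈ L²(ℝ₊)` on `ℝ₊`. -/
def IsWeakDeriv (f g : L2) : Prop :=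
  ∀ φ : ℝ → ℂ, IsTestFunction φ →
    ∫ x in Ioi (0 : ℝ), deriv φ x * f x = - ∫ x in Ioi (0 : ℝ), φ x * g x

/-- `f` belongs to `H¹₀(ℝ₊)`, the closure of `C₀^∞(ℝ₊)` in the `H¹` norm: there is `g ∈ L²(ℝ₊)` (the
derivative of `f`) such that `(f, g)` is a limit in `L² × L²` of pairs `(φ, φ')` with `φ` a test
function. -/
def MemH10 (f : L2) : Prop :=
  ∃ g : L2, (f, g) ∈ closure {p : L2 × L2 | ∃ φ : ℝ → ℂ, IsTestFunction φ ∧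
    p.1 =ᵐ[volume.restrict (Ioi (0 : ℝ))] φ ∧ p.2 =ᵐ[volume.restrict (Ioi (0 : ℝ))] deriv φ}

/-- `f` has the boundary value `f(0) = c`: it has a representative that is continuous on `[0, ∞)`
and takes the value `c` at `0`. -/
def HasBoundaryValue (f : L2) (c : ℂ) : Prop :=
  ∃ w : ℝ → ℂ, ContinuousOn w (Ici 0) ∧ w 0 = c ∧ f =ᵐ[volume.restrict (Ioi (0 : ℝ))] w

theorem IsTestFunction.add {φ χ : ℝ → ℂ} (h : IsTestFunction φ) (k : IsTestFunction χ) :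
    IsTestFunction (φ + χ) where
  smooth := h.smooth.add k.smooth
  compactSupport := h.compactSupport.add k.compactSupport
  support_subset := (tsupport_add φ χ).trans (union_subset h.support_subset k.support_subset)

theorem IsTestFunction.const_smul {φ : ℝ → ℂ} (h : IsTestFunction φ) (c : ℂ) :
    IsTestFunction (c • φ) where
  smooth := h.smooth.const_smul c
  compactSupport := h.compactSupport.smul_left (f := fun _ => c)
  support_subset := (tsupport_smul_subset_right (fun _ => c) φ).trans h.support_subset

theorem IsTestFunction.zero : IsTestFunction 0 where
  smooth := contDiff_const
  compactSupport := HasCompactSupport.zero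
  support_subset := by simp [tsupport]

theorem integrable_mul_L2 {φ : ℝ → ℂ} (hφ : Continuous φ) (hs : HasCompactSupport φ) (f : L2) :
    Integrable (fun x => φ x * f x) (volume.restrict (Ioi (0 : ℝ))) := by
  have h1 : MemLp φ 2 (volume.restrict (Ioi (0 : ℝ))) :=
    (hφ.memLp_of_hasCompactSupport hs).restrict _
  exact h1.integrable_mul (Lp.memLp f)

theorem IsTestFunction.integrable_mul {φ : ℝ → ℂ} (h : IsTestFunction φ) (f : L2) :
    Integrable (fun x => φ x * f x) (volume.restrict (Ioi (0 : ℝ))) :=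
  integrable_mul_L2 h.smooth.continuous h.compactSupport f

theorem IsTestFunction.integrable_deriv_mul {φ : ℝ → ℂ} (h : IsTestFunction φ) (f : L2) :
    Integrable (fun x => deriv φ x * f x) (volume.restrict (Ioi (0 : ℝ))) :=
  integrable_mul_L2 (h.smooth.continuous_deriv (by simp)) h.compactSupport.deriv f

theorem isWeakDeriv_zero : IsWeakDeriv 0 0 := by
  intro φ hφ
  have h := Lp.coeFn_zero ℂ 2 (volume.restrict (Ioi (0 : ℝ)))
  rw [integral_congr_ae (g := fun _ => 0), integral_congr_ae (g := fun _ => (0 : ℂ))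
    (f := fun x => φ x * _)]
  · simp
  · filter_upwards [h] with x hx
    rw [hx, Pi.zero_apply, mul_zero]
  · filter_upwards [h] with x hx
    rw [hx, Pi.zero_apply, mul_zero]

theorem IsWeakDeriv.add {f g f' g' : L2} (h : IsWeakDeriv f g) (h' : IsWeakDeriv f' g') :
    IsWeakDeriv (f + f') (g + g') := by
  intro φ hφ
  have e1 : ∫ x in Ioi (0 : ℝ), deriv φ x * (f + f' : L2) x
      = ∫ x in Ioi (0 : ℝ), (deriv φ x * f x + deriv φ x * f' x) := by
    refine integral_congr_ae ?_
    filter_upwards [Lp.coeFn_add f f'] with x hx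
    rw [hx, Pi.add_apply, mul_add]
  have e2 : ∫ x in Ioi (0 : ℝ), φ x * (g + g' : L2) x
      = ∫ x in Ioi (0 : ℝ), (φ x * g x + φ x * g' x) := by
    refine integral_congr_ae ?_
    filter_upwards [Lp.coeFn_add g g'] with x hx
    rw [hx, Pi.add_apply, mul_add]
  rw [e1, e2, integral_add (hφ.integrable_deriv_mul f) (hφ.integrable_deriv_mul f'),
    integral_add (hφ.integrable_mul g) (hφ.integrable_mul g'), h φ hφ, h' φ hφ]
  ring

theorem IsWeakDeriv.smul {f g : L2} (h : IsWeakDeriv f g) (c : ℂ) :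
    IsWeakDeriv (c • f) (c • g) := by
  intro φ hφ
  have e1 : ∫ x in Ioi (0 : ℝ), deriv φ x * (c • f : L2) x
      = ∫ x in Ioi (0 : ℝ), c * (deriv φ x * f x) := by
    refine integral_congr_ae ?_
    filter_upwards [Lp.coeFn_smul c f] with x hx
    rw [hx, Pi.smul_apply, smul_eq_mul]; ring
  have e2 : ∫ x in Ioi (0 : ℝ), φ x * (c • g : L2) x
      = ∫ x in Ioi (0 : ℝ), c * (φ x * g x) := by
    refine integral_congr_ae ?_
    filter_upwards [Lp.coeFn_smul c g] with x hx
    rw [hx, Pi.smul_apply, smul_eq_mul]; ring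
  rw [e1, e2, integral_const_mul, integral_const_mul, h φ hφ]
  ring

/-- Weak derivatives are unique. -/
theorem IsWeakDeriv.eq_zero {g : L2} (h : IsWeakDeriv 0 g) : g = 0 := by
  have key : ∀ᵐ x ∂(volume : Measure ℝ), x ∈ Ioi (0 : ℝ) → (g : ℝ → ℂ) x = 0 := by
    refine isOpen_Ioi.ae_eq_zero_of_integral_contDiff_smul_eq_zero ?_ ?_
    · intro x hx
      have h1 : LocallyIntegrable (g : ℝ → ℂ) (volume.restrict (Ioi (0 : ℝ))) :=
        (Lp.memLp g).locallyIntegrable (by norm_num)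
      obtain ⟨s, hs, hgs⟩ := h1 x
      refine ⟨Ioi 0 ∩ s, inter_mem_nhdsWithin _ hs, ?_⟩
      rwa [IntegrableOn, Measure.restrict_restrict' measurableSet_Ioi, inter_comm] at hgs
    · intro φ h1 h2 h3
      have hφ : IsTestFunction (fun x => (φ x : ℂ)) := by
        refine ⟨?_, ?_, ?_⟩
        · exact Complex.ofRealCLM.contDiff.comp h1
        · exact h2.comp_left (g := Complex.ofReal) Complex.ofReal_zero
        · exact (tsupport_comp_subset (g := Complex.ofReal) Complex.ofReal_zero φ).trans h3
      have h0 : ∫ x in Ioi (0 : ℝ), deriv (fun x => (φ x : ℂ)) x * (0 : L2) x = 0 := by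
        rw [integral_congr_ae (g := fun _ => 0)]
        · simp
        · filter_upwards [Lp.coeFn_zero ℂ 2 (volume.restrict (Ioi (0 : ℝ)))] with x hx
          rw [hx, Pi.zero_apply, mul_zero]
      have h4 := h _ hφ
      rw [h0, zero_eq_neg] at h4
      rw [← setIntegral_eq_integral_of_forall_compl_eq_zero (s := Ioi (0 : ℝ))]
      · simpa only [Complex.real_smul] using h4
      · intro x hx
        have : φ x = 0 := by
          by_contra hne
          exact hx (h3 (subset_tsupport φ hne))
        simp [this]
  rw [Lp.eq_zero_iff_ae_eq_zero]
  exact (ae_restrict_iff' measurableSet_Ioi).2 key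

theorem MemH10.zero : MemH10 0 := by
  refine ⟨0, subset_closure ⟨0, IsTestFunction.zero, ?_, ?_⟩⟩
  · exact Lp.coeFn_zero ℂ 2 _
  · have : deriv (0 : ℝ → ℂ) = 0 := by ext; simp
    rw [this]; exact Lp.coeFn_zero ℂ 2 _

theorem MemH10.add {f g : L2} (hf : MemH10 f) (hg : MemH10 g) : MemH10 (f + g) := by
  obtain ⟨f', hf⟩ := hf
  obtain ⟨g', hg⟩ := hg
  refine ⟨f' + g', map_mem_closure₂ (f := fun p q : L2 × L2 => p + q) continuous_add hf hg ?_⟩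
  rintro p ⟨φ, h, h1, h2⟩ q ⟨χ, k, k1, k2⟩
  refine ⟨φ + χ, h.add k, (Lp.coeFn_add _ _).trans (h1.add k1), ?_⟩
  have : deriv (φ + χ) = deriv φ + deriv χ := by
    ext x
    exact deriv_add (h.smooth.differentiable (by simp) x) (k.smooth.differentiable (by simp) x)
  rw [this]
  exact (Lp.coeFn_add _ _).trans (h2.add k2)

theorem MemH10.smul {f : L2} (hf : MemH10 f) (c : ℂ) : MemH10 (c • f) := by
  obtain ⟨f', hf⟩ := hf
  refine ⟨c • f', map_mem_closure (f := fun p : L2 × L2 => c • p) (continuous_const_smul c) hf ?_⟩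
  rintro p ⟨φ, h, h1, h2⟩
  refine ⟨c • φ, h.const_smul c, (Lp.coeFn_smul _ _).trans (h1.const_smul c), ?_⟩
  have : deriv (c • φ) = c • deriv φ := by
    ext x
    exact deriv_const_smul c (h.smooth.differentiable (by simp) x)
  rw [this]
  exact (Lp.coeFn_smul _ _).trans (h2.const_smul c)

theorem HasBoundaryValue.zero : HasBoundaryValue 0 0 :=
  ⟨0, continuousOn_const, rfl, Lp.coeFn_zero ℂ 2 _⟩

theorem HasBoundaryValue.add {f g : L2} {a b : ℂ} (hf : HasBoundaryValue f a)
    (hg : HasBoundaryValue g b) : HasBoundaryValue (f + g) (a + b) := by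
  obtain ⟨v, h1, h2, h3⟩ := hf
  obtain ⟨w, k1, k2, k3⟩ := hg
  exact ⟨v + w, h1.add k1, by simp [h2, k2], (Lp.coeFn_add _ _).trans (h3.add k3)⟩

theorem HasBoundaryValue.smul {f : L2} {a : ℂ} (hf : HasBoundaryValue f a) (c : ℂ) :
    HasBoundaryValue (c • f) (c * a) := by
  obtain ⟨v, h1, h2, h3⟩ := hf
  exact ⟨c • v, h1.const_smul c, by simp [h2], (Lp.coeFn_smul _ _).trans (h3.const_smul c)⟩

/-! ### The Dirichlet and Neumann Hamiltonians on the half-line -/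

/-- The graph of `-(ħ² / 2m) d²/dx²` on `{ψ ∈ H²(ℝ₊) | ψ ∈ H¹₀(ℝ₊)}`. -/
def dirichletGraph (hbar m : ℝ) : Submodule ℂ (L2 × L2) where
  carrier := {p | MemH10 p.1 ∧ ∃ ψ₁ ψ₂ : L2, IsWeakDeriv p.1 ψ₁ ∧ IsWeakDeriv ψ₁ ψ₂ ∧
    p.2 = (-(hbar ^ 2 / (2 * m) : ℝ) : ℂ) • ψ₂}
  zero_mem' := ⟨MemH10.zero, 0, 0, isWeakDeriv_zero, isWeakDeriv_zero, by simp⟩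
  add_mem' := by
    rintro p q ⟨h, f₁, f₂, h1, h2, h3⟩ ⟨k, g₁, g₂, k1, k2, k3⟩
    exact ⟨h.add k, f₁ + g₁, f₂ + g₂, h1.add k1, h2.add k2, by
      rw [Prod.snd_add, h3, k3, smul_add]⟩
  smul_mem' := by
    rintro c p ⟨h, f₁, f₂, h1, h2, h3⟩
    exact ⟨h.smul c, c • f₁, c • f₂, h1.smul c, h2.smul c, by
      rw [Prod.smul_snd, h3, smul_comm]⟩

/-- The graph of `-(ħ² / 2m) d²/dx²` on `{ψ ∈ H²(ℝ₊) | ψ'(0) = 0}`. -/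
def neumannGraph (hbar m : ℝ) : Submodule ℂ (L2 × L2) where
  carrier := {p | ∃ ψ₁ ψ₂ : L2, IsWeakDeriv p.1 ψ₁ ∧ IsWeakDeriv ψ₁ ψ₂ ∧ HasBoundaryValue ψ₁ 0 ∧
    p.2 = (-(hbar ^ 2 / (2 * m) : ℝ) : ℂ) • ψ₂}
  zero_mem' := ⟨0, 0, isWeakDeriv_zero, isWeakDeriv_zero, HasBoundaryValue.zero, by simp⟩
  add_mem' := by
    rintro p q ⟨f₁, f₂, h1, h2, h, h3⟩ ⟨g₁, g₂, k1, k2, k, k3⟩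
    exact ⟨f₁ + g₁, f₂ + g₂, h1.add k1, h2.add k2, by simpa using h.add k, by
      rw [Prod.snd_add, h3, k3, smul_add]⟩
  smul_mem' := by
    rintro c p ⟨f₁, f₂, h1, h2, h, h3⟩
    exact ⟨c • f₁, c • f₂, h1.smul c, h2.smul c, by simpa using h.smul c, by
      rw [Prod.smul_snd, h3, smul_comm]⟩

/-- The Dirichlet Hamiltonian `H_D ψ = -(ħ² / 2m) ψ''` with domain `H¹₀(ℝ₊) ∩ H²(ℝ₊)`, as an
unbounded operator on `L²(ℝ₊)`. -/
def dirichletHamiltonian (hbar m : ℝ) : L2 →ₗ.[ℂ] L2 := (dirichletGraph hbar m).toLinearPMap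

/-- The Neumann Hamiltonian `H_N ψ = -(ħ² / 2m) ψ''` with domain `{ψ ∈ H²(ℝ₊) | ψ'(0) = 0}`, as an
unbounded operator on `L²(ℝ₊)`. -/
def neumannHamiltonian (hbar m : ℝ) : L2 →ₗ.[ℂ] L2 := (neumannGraph hbar m).toLinearPMap

theorem snd_eq_zero_of_isWeakDeriv {c : ℂ} {f f₁ f₂ g : L2} (hf : f = 0) (h1 : IsWeakDeriv f f₁)
    (h2 : IsWeakDeriv f₁ f₂) (hg : g = c • f₂) : g = 0 := by
  subst hf
  obtain rfl := h1.eq_zero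
  obtain rfl := h2.eq_zero
  simp [hg]

/-- The graph of the Dirichlet Hamiltonian is the intended one. -/
theorem graph_dirichletHamiltonian (hbar m : ℝ) :
    (dirichletHamiltonian hbar m).graph = dirichletGraph hbar m := by
  refine Submodule.toLinearPMap_graph_eq _ ?_
  rintro p ⟨-, ψ₁, ψ₂, h1, h2, h3⟩ h0
  exact snd_eq_zero_of_isWeakDeriv h0 h1 h2 h3

/-- The graph of the Neumann Hamiltonian is the intended one. -/
theorem graph_neumannHamiltonian (hbar m : ℝ) :
    (neumannHamiltonian hbar m).graph = neumannGraph hbar m := by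
  refine Submodule.toLinearPMap_graph_eq _ ?_
  rintro p ⟨ψ₁, ψ₂, h1, h2, -, h3⟩ h0
  exact snd_eq_zero_of_isWeakDeriv h0 h1 h2 h3

/-! ### Unitary groups -/

/-- `U_t = exp(-i (t / ħ) A)`: `U` is the strongly continuous one-parameter unitary group generated
(in the sense of Stone's theorem) by the operator `A`. That is, `ψ ∈ dom A` with `A ψ = χ` if and
only if `(U_t ψ - ψ) / t` converges to `-(i / ħ) χ` as `t → 0`. -/
structure IsUnitaryGroupOf (hbar : ℝ) (A : L2 →ₗ.[ℂ] L2) (U : ℝ → (L2 →L[ℂ] L2)) : Prop where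
  unitary : ∀ t, U t ∈ unitary (L2 →L[ℂ] L2)
  map_zero : U 0 = 1
  map_add : ∀ s t, U (s + t) = U s * U t
  continuous : ∀ ψ, Continuous fun t => U t ψ
  generator : ∀ ψ χ : L2, (ψ, χ) ∈ A.graph ↔
    Tendsto (fun t : ℝ => (t : ℂ)⁻¹ • (U t ψ - ψ)) (𝓝[≠] 0) (𝓝 (-(Complex.I / hbar) • χ))

/-- `Ω = s-lim T_t` along the filter `l`. -/
def IsStrongLimit (T : ℝ → (L2 →L[ℂ] L2)) (l : Filter ℝ) (Ω : L2 →L[ℂ] L2) : Prop :=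
  ∀ ψ : L2, Tendsto (fun t => T t ψ) l (𝓝 (Ω ψ))

/-! ### The Fourier sine and cosine transforms -/

/-- Restriction `L²(ℝ) → L²(ℝ₊)`. -/
def restrict : L2Line →L[ℂ] L2 := LpToLpRestrictCLM ℝ ℂ ℂ volume 2 (Ioi 0)

/-- Extension by zero `L²(ℝ₊) → L²(ℝ)`, the adjoint of the restriction. -/
def extend : L2 →L[ℂ] L2Line := ContinuousLinearMap.adjoint restrict

/-- The parity operator `(P f)(x) = f(-x)` on `L²(ℝ)`. -/
def parity : L2Line →L[ℂ] L2Line :=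
  (Lp.compMeasurePreservingₗᵢ ℂ (fun x : ℝ => -x)
    (Measure.measurePreserving_neg volume)).toContinuousLinearMap

theorem map_dilation :
    Measure.map (fun k : ℝ => (2 * Real.pi)⁻¹ * k) volume
      = ENNReal.ofReal (2 * Real.pi) • (volume : Measure ℝ) := by
  have h := Real.map_volume_mul_left (a := (2 * Real.pi)⁻¹) (by positivity)
  rw [inv_inv, abs_of_pos (by positivity)] at h
  exact h

theorem dilation_quasi :
    Measure.QuasiMeasurePreserving (fun k : ℝ => (2 * Real.pi)⁻¹ * k) volume volume :=
  ⟨by fun_prop, by rw [map_dilation]; exact Measure.smul_absolutelyContinuous⟩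

theorem memLp_dilation (f : L2Line) : MemLp (fun k : ℝ => f ((2 * Real.pi)⁻¹ * k)) 2 volume := by
  have hm : AEMeasurable (fun k : ℝ => (2 * Real.pi)⁻¹ * k) volume := by fun_prop
  have h : MemLp f 2 (Measure.map (fun k : ℝ => (2 * Real.pi)⁻¹ * k) volume) := by
    rw [map_dilation]
    exact (Lp.memLp f).smul_measure ENNReal.ofReal_ne_top
  exact (memLp_map_measure_iff h.1 hm).1 h

theorem norm_dilation (f : L2Line) : ‖(memLp_dilation f).toLp‖ = √(2 * Real.pi) * ‖f‖ := by
  have hm : AEMeasurable (fun k : ℝ => (2 * Real.pi)⁻¹ * k) volume := by fun_prop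
  have h : AEStronglyMeasurable f (Measure.map (fun k : ℝ => (2 * Real.pi)⁻¹ * k) volume) := by
    rw [map_dilation]
    exact (Lp.aestronglyMeasurable f).smul_measure _
  have e := eLpNorm_map_measure (p := 2) h hm
  rw [map_dilation, eLpNorm_smul_measure_of_ne_top (by norm_num)] at e
  have e' : eLpNorm (fun k : ℝ => f ((2 * Real.pi)⁻¹ * k)) 2 volume = _ := e.symm
  rw [Lp.norm_toLp, e', Lp.norm_def, smul_eq_mul, ENNReal.toReal_mul, ← ENNReal.toReal_rpow,
    ENNReal.toReal_ofReal (by positivity), Real.sqrt_eq_rpow]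
  norm_num

/-- The dilation `(D f)(k) = f(k / 2π)` on `L²(ℝ)`. -/
def dilation : L2Line →L[ℂ] L2Line :=
  LinearMap.mkContinuous
    { toFun := fun f => (memLp_dilation f).toLp
      map_add' := fun f g => by
        rw [← MemLp.toLp_add]
        refine MemLp.toLp_congr _ _ ?_
        exact dilation_quasi.ae_eq_comp (Lp.coeFn_add f g)
      map_smul' := fun c f => by
        rw [RingHom.id_apply, ← MemLp.toLp_const_smul]
        refine MemLp.toLp_congr _ _ ?_
        exact dilation_quasi.ae_eq_comp (Lp.coeFn_smul c f) }
    (√(2 * Real.pi)) (fun f => (norm_dilation f).le)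

/-- The Fourier transform on `L²(ℝ)` with the normalization
`(F f)(k) = (2π)^{-1/2} ∫ e^{-ikx} f(x) dx`, obtained from Mathlib's `∫ e^{-2πiξx} f(x) dx`. -/
def fourierLine : L2Line →L[ℂ] L2Line :=
  ((√(2 * Real.pi))⁻¹ : ℂ) • dilation ∘L
    (Lp.fourierTransformₗᵢ ℝ ℂ).toContinuousLinearEquiv.toContinuousLinearMap

/-- The Fourier-sine transform on `L²(ℝ₊)`,
`(F_s ψ)(k) = -(2i / √(2π)) ∫₀^∞ sin(kx) ψ(x) dx`: the restriction to `ℝ₊` of the Fourier transform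
of the odd extension of `ψ`. See `sineTransform_ae_eq` for the integral formula. -/
def sineTransform : L2 →L[ℂ] L2 :=
  restrict ∘L fourierLine ∘L (1 - parity) ∘L extend

/-- The Fourier-cosine transform on `L²(ℝ₊)`,
`(F_c ψ)(k) = (2 / √(2π)) ∫₀^∞ cos(kx) ψ(x) dx`: the restriction to `ℝ₊` of the Fourier transform
of the even extension of `ψ`. See `cosineTransform_ae_eq` for the integral formula. -/
def cosineTransform : L2 →L[ℂ] L2 :=
  restrict ∘L fourierLine ∘L (1 + parity) ∘L extend

theorem fourier_ae_eq (f : L2Line) (hf : Integrable f) :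
    (Lp.fourierTransformₗᵢ ℝ ℂ f : ℝ → ℂ) =ᵐ[volume]
      fun ξ => ∫ x, Complex.exp (-(2 * Real.pi * x * ξ : ℝ) * Complex.I) * f x := by
  have hF : (fun ξ : ℝ => ∫ x, Complex.exp (-(2 * Real.pi * x * ξ : ℝ) * Complex.I) * f x)
      = 𝓕 (f : ℝ → ℂ) := by
    ext ξ
    rw [Real.fourier_real_eq_integral_exp_smul]
    simp
  rw [hF]
  have hcont : Continuous (𝓕 (f : ℝ → ℂ)) :=
    VectorFourier.fourierIntegral_continuous Real.continuous_fourierChar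
      (L := innerₗ ℝ) continuous_inner hf
  refine ae_eq_of_integral_contDiff_smul_eq ((Lp.memLp _).locallyIntegrable (by norm_num))
    hcont.locallyIntegrable ?_
  intro g g1 g2
  have hg₁ : HasCompactSupport (Complex.ofRealCLM ∘ g) := g2.comp_left rfl
  have hg₂ : ContDiff ℝ ∞ (Complex.ofRealCLM ∘ g) := by fun_prop
  set s := hg₁.toSchwartzMap hg₂ with hs
  have hsg : ∀ x, s x = (g x : ℂ) := fun x => rfl
  have h1 := congrArg (fun T => T s) (Lp.fourier_toTemperedDistribution_eq f)
  simp only [TemperedDistribution.fourier_apply, Lp.toTemperedDistribution_apply] at h1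
  have h2 : ∫ x, g x • (Lp.fourierTransformₗᵢ ℝ ℂ f : ℝ → ℂ) x = ∫ x, s x • (𝓕 f : L2Line) x := by
    refine integral_congr_ae (Eventually.of_forall fun x => ?_)
    simp only [hsg, Complex.real_smul, smul_eq_mul]
    rfl
  have h3 : ∫ x, 𝓕 (s : ℝ → ℂ) x • f x = ∫ x, s x • 𝓕 (f : ℝ → ℂ) x := by
    simpa using! VectorFourier.integral_fourierIntegral_smul_eq_flip (L := innerₗ ℝ)
      Real.continuous_fourierChar continuous_inner s.integrable hf
  rw [h2, ← h1]
  refine Eq.trans ?_ (h3.trans ?_)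
  · rfl
  · refine integral_congr_ae (Eventually.of_forall fun x => ?_)
    simp only [hsg, Complex.real_smul, smul_eq_mul]

theorem fourierLine_ae_eq (f : L2Line) (hf : Integrable f) :
    (fourierLine f : ℝ → ℂ) =ᵐ[volume]
      fun k => (√(2 * Real.pi) : ℂ)⁻¹ * ∫ x, Complex.exp (-(k * x : ℝ) * Complex.I) * f x := by
  have h1 : (dilation (Lp.fourierTransformₗᵢ ℝ ℂ f) : ℝ → ℂ) =ᵐ[volume]
      fun k => ∫ x, Complex.exp (-(k * x : ℝ) * Complex.I) * f x := by
    refine (MemLp.coeFn_toLp (memLp_dilation (Lp.fourierTransformₗᵢ ℝ ℂ f))).trans ?_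
    refine (dilation_quasi.ae_eq_comp (fourier_ae_eq f hf)).trans ?_
    refine Eventually.of_forall fun k => ?_
    refine integral_congr_ae (Eventually.of_forall fun x => ?_)
    have : 2 * Real.pi * x * ((2 * Real.pi)⁻¹ * k) = k * x := by field_simp
    simp only [this]
  refine (Lp.coeFn_smul _ _).trans ?_
  filter_upwards [h1] with k hk
  rw [Pi.smul_apply, smul_eq_mul]
  exact congrArg _ hk

theorem extend_ae_eq (ψ : L2) : (extend ψ : ℝ → ℂ) =ᵐ[volume] (Ioi (0 : ℝ)).indicator ψ := by
  have hm : MemLp ((Ioi (0 : ℝ)).indicator ψ) 2 volume :=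
    (memLp_indicator_iff_restrict measurableSet_Ioi).2 (Lp.memLp ψ)
  have : extend ψ = hm.toLp := by
    refine ext_inner_right ℂ fun v => ?_
    rw [extend, ContinuousLinearMap.adjoint_inner_left, L2.inner_def, L2.inner_def]
    rw [← integral_indicator measurableSet_Ioi]
    refine integral_congr_ae ?_
    have hr : ∀ᵐ x ∂(volume : Measure ℝ), x ∈ Ioi (0 : ℝ) → restrict v x = v x :=
      (ae_restrict_iff' measurableSet_Ioi).1 (LpToLpRestrictCLM_coeFn ℂ (Ioi 0) v)
    filter_upwards [hm.coeFn_toLp, hr] with x hx hx'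
    rw [hx]
    by_cases h : x ∈ Ioi (0 : ℝ)
    · simp only [indicator_of_mem h, hx' h]
    · simp [indicator_of_notMem h]
  rw [this]
  exact hm.coeFn_toLp

theorem parity_ae_eq (f : L2Line) : (parity f : ℝ → ℂ) =ᵐ[volume] fun x => f (-x) :=
  Lp.coeFn_compMeasurePreserving f (Measure.measurePreserving_neg volume)

theorem integrable_indicator {ψ : L2} (hψ : Integrable ψ (volume.restrict (Ioi (0 : ℝ)))) (c : ℝ) :
    Integrable (fun x => Complex.exp ((c * x : ℝ) * Complex.I) * (Ioi (0 : ℝ)).indicator ψ x) := by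
  have h : Integrable ((Ioi (0 : ℝ)).indicator ψ) := (integrable_indicator_iff measurableSet_Ioi).2 hψ
  refine h.bdd_mul (c := 1) (by fun_prop) (Eventually.of_forall fun x => ?_)
  rw [Complex.norm_exp_ofReal_mul_I]

theorem restrict_fourierLine_ae_eq (ψ : L2) (hψ : Integrable ψ (volume.restrict (Ioi (0 : ℝ))))
    (s : ℂ) (f : L2Line) (hf : f = extend ψ + s • parity (extend ψ)) :
    (restrict (fourierLine f) : ℝ → ℂ) =ᵐ[volume.restrict (Ioi (0 : ℝ))]
      fun k => (√(2 * Real.pi) : ℂ)⁻¹ * ∫ x in Ioi (0 : ℝ),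
        (Complex.exp (-(k * x : ℝ) * Complex.I) + s * Complex.exp ((k * x : ℝ) * Complex.I)) * ψ x := by
  have hx := extend_ae_eq ψ
  have hp : (parity (extend ψ) : ℝ → ℂ) =ᵐ[volume] fun x => (Ioi (0 : ℝ)).indicator ψ (-x) :=
    (parity_ae_eq _).trans
      ((Measure.measurePreserving_neg (volume : Measure ℝ)).quasiMeasurePreserving.ae_eq_comp hx)
  have hfe : (f : ℝ → ℂ) =ᵐ[volume]
      fun x => (Ioi (0 : ℝ)).indicator ψ x + s * (Ioi (0 : ℝ)).indicator ψ (-x) := by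
    rw [hf]
    filter_upwards [hx, hp, Lp.coeFn_add (extend ψ) (s • parity (extend ψ)),
      Lp.coeFn_smul s (parity (extend ψ))] with x h1 h2 h3 h4
    rw [h3, Pi.add_apply, h4, Pi.smul_apply, h1, h2, smul_eq_mul]
  have hi : Integrable ((Ioi (0 : ℝ)).indicator ψ) :=
    (integrable_indicator_iff measurableSet_Ioi).2 hψ
  have hfi : Integrable f := (hi.add (hi.comp_neg.const_mul s)).congr hfe.symm
  refine (LpToLpRestrictCLM_coeFn ℂ (Ioi 0) (fourierLine f)).trans ?_
  refine EventuallyEq.trans (ae_restrict_of_ae (fourierLine_ae_eq f hfi))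
    (Eventually.of_forall fun k => ?_)
  refine congrArg _ ?_
  have e1 := integrable_indicator hψ (-k)
  have e2 := integrable_indicator hψ k
  have e3 : Integrable (fun x : ℝ => Complex.exp (-(k * x : ℝ) * Complex.I) *
      (Ioi (0 : ℝ)).indicator ψ (-x)) := by
    simpa using e2.comp_neg
  calc ∫ x, Complex.exp (-(k * x : ℝ) * Complex.I) * f x
      = ∫ x, (Complex.exp (((-k) * x : ℝ) * Complex.I) * (Ioi (0 : ℝ)).indicator ψ x
          + s * (Complex.exp (-(k * x : ℝ) * Complex.I) * (Ioi (0 : ℝ)).indicator ψ (-x))) := by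
        refine integral_congr_ae ?_
        filter_upwards [hfe] with x h
        rw [h]
        push_cast
        ring_nf
    _ = (∫ x, Complex.exp (((-k) * x : ℝ) * Complex.I) * (Ioi (0 : ℝ)).indicator ψ x)
          + s * ∫ x, Complex.exp ((k * x : ℝ) * Complex.I) * (Ioi (0 : ℝ)).indicator ψ x := by
        rw [integral_add e1 (e3.const_mul s), integral_const_mul]
        rw [← integral_neg_eq_self
          (fun x : ℝ => Complex.exp (-(k * x : ℝ) * Complex.I) * (Ioi (0 : ℝ)).indicator ψ (-x))]
        simp
    _ = ∫ x, (Complex.exp (((-k) * x : ℝ) * Complex.I) * (Ioi (0 : ℝ)).indicator ψ x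
          + s * (Complex.exp ((k * x : ℝ) * Complex.I) * (Ioi (0 : ℝ)).indicator ψ x)) := by
        rw [integral_add e1 (e2.const_mul s), integral_const_mul]
    _ = _ := by
        rw [← integral_indicator measurableSet_Ioi]
        refine integral_congr_ae (Eventually.of_forall fun x => ?_)
        by_cases h : x ∈ Ioi (0 : ℝ)
        · simp only [indicator_of_mem h]
          push_cast
          ring_nf
        · simp [indicator_of_notMem h]

/-- On integrable functions the Fourier-sine transform is given by the integral formula. -/
theorem sineTransform_ae_eq (ψ : L2) (hψ : Integrable ψ (volume.restrict (Ioi (0 : ℝ)))) :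
    (sineTransform ψ : ℝ → ℂ) =ᵐ[volume.restrict (Ioi (0 : ℝ))]
      fun k => -(2 * Complex.I / √(2 * Real.pi)) *
        ∫ x in Ioi (0 : ℝ), (Real.sin (k * x) : ℂ) * ψ x := by
  refine (restrict_fourierLine_ae_eq ψ hψ (-1) ((1 - parity) (extend ψ)) ?_).trans
    (Eventually.of_forall fun k => ?_)
  · simp [sub_eq_add_neg]
  · have : ∀ x : ℝ, (Complex.exp (-(k * x : ℝ) * Complex.I)
        + -1 * Complex.exp ((k * x : ℝ) * Complex.I)) * ψ x
        = -(2 * Complex.I) * ((Real.sin (k * x) : ℂ) * ψ x) := by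
      intro x
      rw [Complex.ofReal_sin, Complex.sin]
      linear_combination (Complex.exp (-(k * x : ℝ) * Complex.I) -
        Complex.exp ((k * x : ℝ) * Complex.I)) * ψ x * Complex.I_sq
    simp only [this]
    rw [integral_const_mul]
    ring

/-- On integrable functions the Fourier-cosine transform is given by the integral formula. -/
theorem cosineTransform_ae_eq (ψ : L2) (hψ : Integrable ψ (volume.restrict (Ioi (0 : ℝ)))) :
    (cosineTransform ψ : ℝ → ℂ) =ᵐ[volume.restrict (Ioi (0 : ℝ))]
      fun k => (2 / √(2 * Real.pi) : ℂ) *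
        ∫ x in Ioi (0 : ℝ), (Real.cos (k * x) : ℂ) * ψ x := by
  refine (restrict_fourierLine_ae_eq ψ hψ 1 ((1 + parity) (extend ψ)) ?_).trans
    (Eventually.of_forall fun k => ?_)
  · simp
  · have : ∀ x : ℝ, (Complex.exp (-(k * x : ℝ) * Complex.I)
        + 1 * Complex.exp ((k * x : ℝ) * Complex.I)) * ψ x
        = 2 * ((Real.cos (k * x) : ℂ) * ψ x) := by
      intro x
      rw [Complex.ofReal_cos, Complex.cos]
      ring
    simp only [this]
    rw [integral_const_mul]
    ring

end HalfLine

end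

/-!
The Fourier-sine transform `F_s` and the Fourier-cosine transform `F_c` are unitary, with
`F_s* = -F_s` and `F_c* = F_c`, and they turn the Dirichlet and the Neumann Hamiltonian into
multiplication by `ħ α k²`, where `α = ħ / 2m`. With `M_t` multiplication by `exp (-i t α k²)`, the
two groups are therefore `U^D_t = F_s* M_t F_s` and `U^N_t = F_c* M_t F_c`, and
`U^N_{-t} U^D_t ψ - σ F_c* F_s ψ`, for a sign `σ = ±1`, has the same norm as
`(F_c + σ F_s) M_t F_s ψ`. The operator `F_c + σ F_s` has the kernel `(2 / √(2π)) exp (-i σ k x)`, so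
this is an oscillatory integral over `k > 0` with phase `-σ (x k + σ t α k²)`. If `σ t > 0`, it has no
stationary point, and for test functions one integration by parts bounds it by `D / (x + a σ t)`,
which tends to zero in `L²(ℝ₊)` as `σ t → ∞` (`IsTestFunction.norm_oscillatory_integral_le`,
`tendsto_cosineTransform_add_smul_sineTransform`). This gives both limits.

That the two operators, with the domains given, generate these groups rests on three facts.

* A weakly differentiable `f ∈ L²(ℝ₊)` has an absolutely continuous representative
  (`IsWeakDeriv.exists_isPrimitiveOf`, from the du Bois-Reymond lemma). It vanishes at infinity, and
  at `0` if `f ∈ H¹₀(ℝ₊)`; hence `F_s f' = i k F_c f`, and `F_c f' = i k F_s f` if `f(0) = 0`. So each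
  Hamiltonian is contained in the corresponding multiplication operator.
* `-d²/dx² + 1` is surjective on either domain (`exists_weak_solution`). Since `k² + 1` has no zeros,
  a surjective restriction of multiplication by `k² + 1` is the whole operator
  (`isUnitaryGroupOf_of_diagonal`).
* A unitary group is determined by its generator (`IsUnitaryGroupOf.unique`): for two groups with the
  same generator, `‖U_t ψ - V_t ψ‖²` has derivative zero.
-/

noncomputable section

namespace HalfLine

open scoped InnerProductSpace

/-! ### Integration by parts for primitives -/

theorem absolutelyContinuousOnInterval_primitive {g : ℝ → ℂ} {R : ℝ}
    (hg : IntervalIntegrable g volume 0 R) :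
    AbsolutelyContinuousOnInterval (fun x => ∫ t in (0 : ℝ)..x, g t) 0 R := by
  have hre : IntervalIntegrable (fun t => (g t).re) volume 0 R := ⟨hg.1.re, hg.2.re⟩
  have him : IntervalIntegrable (fun t => (g t).im) volume 0 R := ⟨hg.1.im, hg.2.im⟩
  have h0 : (0 : ℝ) ∈ uIcc 0 R := left_mem_uIcc
  have hconst : ∀ c : ℂ, AbsolutelyContinuousOnInterval (fun _ : ℝ => c) 0 R := fun c =>
    ContDiffOn.absolutelyContinuousOnInterval contDiffOn_const
  have h1 := (hre.absolutelyContinuousOnInterval_intervalIntegral h0).smul (hconst 1)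
  have h2 := (him.absolutelyContinuousOnInterval_intervalIntegral h0).smul (hconst Complex.I)
  have h3 := h1.add h2
  have key : ∀ x ∈ uIcc 0 R, ((fun x => ∫ t in (0 : ℝ)..x, (g t).re) • (fun _ : ℝ => (1 : ℂ)) +
      (fun x => ∫ t in (0 : ℝ)..x, (g t).im) • (fun _ : ℝ => Complex.I)) x
      = ∫ t in (0 : ℝ)..x, g t := by
    intro x hx
    have hgx : IntervalIntegrable g volume 0 x := hg.mono_set (uIcc_subset_uIcc_left hx)
    have e : ∀ t, g t = ((g t).re : ℂ) + ((g t).im : ℂ) * Complex.I := fun t =>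
      (Complex.re_add_im _).symm
    have e1 : IntervalIntegrable (fun t => ((g t).re : ℂ)) volume 0 x :=
      ⟨hgx.1.re.ofReal, hgx.2.re.ofReal⟩
    have e2 : IntervalIntegrable (fun t => ((g t).im : ℂ)) volume 0 x :=
      ⟨hgx.1.im.ofReal, hgx.2.im.ofReal⟩
    rw [intervalIntegral.integral_congr (g := fun t => ((g t).re : ℂ) + ((g t).im : ℂ) * Complex.I)
      (fun t _ => e t), intervalIntegral.integral_add e1 (e2.mul_const _),
      intervalIntegral.integral_mul_const, intervalIntegral.integral_ofReal,
      intervalIntegral.integral_ofReal]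
    simp
  rw [absolutelyContinuousOnInterval_iff] at h3 ⊢
  intro ε hε
  obtain ⟨δ, hδ, H⟩ := h3 ε hε
  refine ⟨δ, hδ, fun E hE hE' => ?_⟩
  have := H E hE hE'
  refine lt_of_eq_of_lt (Finset.sum_congr rfl fun i hi => ?_) this
  rw [key _ (hE.1 i hi).1, key _ (hE.1 i hi).2]

/-- Integration by parts for two primitives of merely integrable functions. -/
theorem integral_mul_add_mul_of_primitive {g v F V : ℝ → ℂ} {R : ℝ} (hR : 0 ≤ R)
    (hg : IntervalIntegrable g volume 0 R) (hv : IntervalIntegrable v volume 0 R)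
    (hF : ∀ x ∈ Icc 0 R, F x = F 0 + ∫ t in (0 : ℝ)..x, g t)
    (hV : ∀ x ∈ Icc 0 R, V x = V 0 + ∫ t in (0 : ℝ)..x, v t) :
    ∫ x in (0 : ℝ)..R, (g x * V x + F x * v x) = F R * V R - F 0 * V 0 := by
  have hconst : ∀ c : ℂ, AbsolutelyContinuousOnInterval (fun _ : ℝ => c) 0 R := fun c =>
    ContDiffOn.absolutelyContinuousOnInterval contDiffOn_const
  set F' : ℝ → ℂ := (fun _ => F 0) + fun x => ∫ t in (0 : ℝ)..x, g t with hF'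
  set V' : ℝ → ℂ := (fun _ => V 0) + fun x => ∫ t in (0 : ℝ)..x, v t with hV'
  have aF : AbsolutelyContinuousOnInterval F' 0 R :=
    (hconst _).add (absolutelyContinuousOnInterval_primitive hg)
  have aV : AbsolutelyContinuousOnInterval V' 0 R :=
    (hconst _).add (absolutelyContinuousOnInterval_primitive hv)
  have hi : IntervalIntegrable (fun x => g x * V' x + F' x * v x) volume 0 R :=
    (hg.mul_continuousOn aV.continuousOn).add (hv.continuousOn_mul aF.continuousOn)
  have aΦ := (aF.smul aV).sub (absolutelyContinuousOnInterval_primitive hi)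
  obtain ⟨C, hC⟩ := aΦ.const_of_ae_hasDerivAt_zero (by
    filter_upwards [hg.ae_hasDerivAt_integral, hv.ae_hasDerivAt_integral,
      hi.ae_hasDerivAt_integral] with x h1 h2 h3 hx
    have d1 : HasDerivAt F' (g x) x := by
      have := (h1 hx 0 left_mem_uIcc).const_add (F 0)
      exact this
    have d2 : HasDerivAt V' (v x) x := by
      have := (h2 hx 0 left_mem_uIcc).const_add (V 0)
      exact this
    have d3 := (d1.mul d2).sub (h3 hx 0 left_mem_uIcc)
    rw [sub_self] at d3
    exact d3)
  have c0 := hC 0 left_mem_uIcc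
  have cR := hC R right_mem_uIcc
  have eF : ∀ x ∈ Icc 0 R, F' x = F x := fun x hx => (hF x hx).symm
  have eV : ∀ x ∈ Icc 0 R, V' x = V x := fun x hx => (hV x hx).symm
  have m0 : (0 : ℝ) ∈ Icc 0 R := ⟨le_rfl, hR⟩
  have mR : R ∈ Icc 0 R := ⟨hR, le_rfl⟩
  simp only [Pi.sub_apply, smul_eq_mul, Pi.mul_apply, intervalIntegral.integral_same,
    sub_zero] at c0 cR
  rw [eF _ m0, eV _ m0] at c0
  rw [eF _ mR, eV _ mR] at cR
  rw [intervalIntegral.integral_congr (g := fun x => g x * V' x + F' x * v x)]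
  · rw [c0, ← cR]; ring
  · intro x hx
    rw [uIcc_of_le hR] at hx
    simp only [eF x hx, eV x hx]

/-! ### Continuous representatives -/

theorem integrableOn_L2 (f : L2) {a b : ℝ} (ha : 0 ≤ a) : IntegrableOn f (Ioc a b) := by
  have h : IntegrableOn f (Ioc a b) (volume.restrict (Ioi (0 : ℝ))) := by
    have h2 : MemLp f 2 ((volume.restrict (Ioi (0 : ℝ))).restrict (Ioc a b)) :=
      (Lp.memLp f).restrict _
    have : IsFiniteMeasure ((volume.restrict (Ioi (0 : ℝ))).restrict (Ioc a b)) :=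
      ⟨lt_of_le_of_lt (Measure.restrict_apply_univ _ ▸ Measure.restrict_apply_le _ _)
        (by simp)⟩
    exact h2.integrable (by norm_num)
  rwa [IntegrableOn, Measure.restrict_restrict measurableSet_Ioc,
    inter_eq_left.2 (fun x hx => mem_Ioi.2 (lt_of_le_of_lt ha hx.1))] at h

theorem intervalIntegrable_L2 (f : L2) {a b : ℝ} (ha : 0 ≤ a) (hb : 0 ≤ b) :
    IntervalIntegrable f volume a b :=
  ⟨integrableOn_L2 f ha, integrableOn_L2 f hb⟩

/-- `F` represents `f` on `ℝ₊` and is, on `[0, ∞)`, a primitive of `g`. -/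
structure IsPrimitiveOf (F : ℝ → ℂ) (f g : L2) : Prop where
  eq_integral : ∀ x, 0 ≤ x → F x = F 0 + ∫ t in (0 : ℝ)..x, g t
  ae_eq : f =ᵐ[volume.restrict (Ioi (0 : ℝ))] F

theorem IsTestFunction.integrable_mul_of_locallyIntegrableOn {φ w : ℝ → ℂ} (h : IsTestFunction φ)
    (hw : LocallyIntegrableOn w (Ioi 0)) : Integrable fun x => φ x * w x := by
  have h1 : IntegrableOn w (tsupport φ) :=
    hw.integrableOn_compact_subset h.support_subset h.compactSupport
  have h2 : IntegrableOn (fun x => φ x * w x) (tsupport φ) :=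
    h1.continuousOn_mul h.smooth.continuous.continuousOn h.compactSupport
  refine (integrableOn_iff_integrable_of_support_subset ?_).1 h2
  exact (Function.support_mul_subset_left φ w).trans (subset_tsupport φ)

/-- The fundamental lemma of the calculus of variations on `ℝ₊`, for complex test functions. -/
theorem ae_eq_zero_of_forall_isTestFunction {w : ℝ → ℂ} (hw : LocallyIntegrableOn w (Ioi 0))
    (h : ∀ φ, IsTestFunction φ → ∫ x in Ioi (0 : ℝ), φ x * w x = 0) :
    w =ᵐ[volume.restrict (Ioi (0 : ℝ))] 0 := by
  refine (ae_restrict_iff' measurableSet_Ioi).2 ?_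
  refine isOpen_Ioi.ae_eq_zero_of_integral_contDiff_smul_eq_zero hw fun φ h1 h2 h3 => ?_
  have hφ : IsTestFunction (fun x => (φ x : ℂ)) :=
    ⟨Complex.ofRealCLM.contDiff.comp h1, h2.comp_left (g := Complex.ofReal) Complex.ofReal_zero,
      (tsupport_comp_subset (g := Complex.ofReal) Complex.ofReal_zero φ).trans h3⟩
  rw [← setIntegral_eq_integral_of_forall_compl_eq_zero (s := Ioi (0 : ℝ))]
  · simpa only [Complex.real_smul] using h _ hφ
  · intro x hx
    have : φ x = 0 := by
      by_contra hne
      exact hx (h3 (subset_tsupport φ hne))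
    simp [this]

theorem IsTestFunction.deriv {φ : ℝ → ℂ} (h : IsTestFunction φ) : IsTestFunction (deriv φ) where
  smooth := (contDiff_infty_iff_deriv.1 h.smooth).2
  compactSupport := h.compactSupport.deriv
  support_subset := tsupport_deriv_subset.trans h.support_subset

theorem IsTestFunction.eq_zero {φ : ℝ → ℂ} (h : IsTestFunction φ) {x : ℝ} (hx : x ≤ 0) :
    φ x = 0 := by
  by_contra hne
  exact absurd (h.support_subset (subset_tsupport φ hne)) (not_lt.2 hx)

theorem IsTestFunction.exists_tsupport_subset_Ico {φ : ℝ → ℂ} (h : IsTestFunction φ) :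
    ∃ a b : ℝ, 0 < a ∧ a < b ∧ tsupport φ ⊆ Ico a b := by
  rcases (tsupport φ).eq_empty_or_nonempty with h0 | h0
  · exact ⟨1, 2, by norm_num, by norm_num, by simp [h0]⟩
  obtain ⟨a, ha, ha'⟩ := h.compactSupport.isCompact.exists_isLeast h0
  obtain ⟨b, hb, hb'⟩ := h.compactSupport.isCompact.exists_isGreatest h0
  exact ⟨a, b + 1, h.support_subset ha, (ha' hb).trans_lt (lt_add_one b), fun x hx =>
    ⟨ha' hx, (hb' hx).trans_lt (lt_add_one b)⟩⟩

theorem integral_Ioi_eq_of_tsupport_subset {φ : ℝ → ℂ} (w : ℝ → ℂ) {a b : ℝ}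
    (hb : 0 ≤ b) (hφ : tsupport φ ⊆ Ico a b) :
    ∫ x in Ioi (0 : ℝ), φ x * w x = ∫ x in (0 : ℝ)..b, φ x * w x := by
  rw [intervalIntegral.integral_of_le hb]
  refine (setIntegral_eq_of_subset_of_forall_sdiff_eq_zero measurableSet_Ioi Ioc_subset_Ioi_self
    fun x hx => ?_)
  rw [image_eq_zero_of_notMem_tsupport fun h => hx.2 ⟨hx.1, (hφ h).2.le⟩, zero_mul]

/-- A test function of integral zero is the derivative of a test function. -/
theorem IsTestFunction.exists_deriv_eq {φ : ℝ → ℂ} (h : IsTestFunction φ)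
    (h0 : ∫ x in Ioi (0 : ℝ), φ x = 0) : ∃ Φ, IsTestFunction Φ ∧ _root_.deriv Φ = φ := by
  obtain ⟨a, b, ha, hab, hsub⟩ := h.exists_tsupport_subset_Ico
  have h1 : ∀ x, x < a → φ x = 0 := fun x hx =>
    image_eq_zero_of_notMem_tsupport fun h => absurd (hsub h).1 (not_le.2 hx)
  have hc := h.smooth.continuous
  have hd : ∀ x, HasDerivAt (fun x => ∫ t in (0 : ℝ)..x, φ t) (φ x) x := fun x =>
    hc.integral_hasStrictDerivAt 0 x |>.hasDerivAt
  have hde : _root_.deriv (fun x => ∫ t in (0 : ℝ)..x, φ t) = φ := funext fun x => (hd x).deriv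
  have z1 : ∀ x, x < a → ∫ t in (0 : ℝ)..x, φ t = 0 := by
    intro x hx
    rw [intervalIntegral.integral_congr (g := fun _ => 0)]
    · simp
    · intro t ht
      refine h1 t ?_
      rcases le_total 0 x with h | h
      · rw [uIcc_of_le h] at ht; exact ht.2.trans_lt hx
      · rw [uIcc_of_ge h] at ht; exact ht.2.trans_lt ha
  have z2 : ∀ x, b ≤ x → ∫ t in (0 : ℝ)..x, φ t = 0 := by
    intro x hx
    have := integral_Ioi_eq_of_tsupport_subset (fun _ => 1) (ha.le.trans (hab.le.trans hx))
      (hsub.trans (Ico_subset_Ico_right hx))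
    simp only [mul_one] at this
    rw [← this, h0]
  have hs : Function.support (fun x => ∫ t in (0 : ℝ)..x, φ t) ⊆ Icc a b := by
    intro x hx
    constructor
    · by_contra hlt; exact hx (z1 x (not_le.1 hlt))
    · by_contra hlt; exact hx (z2 x (not_le.1 hlt).le)
  refine ⟨_, ⟨contDiff_infty_iff_deriv.2 ⟨fun x => (hd x).differentiableAt, ?_⟩,
    HasCompactSupport.of_support_subset_isCompact isCompact_Icc hs, ?_⟩, hde⟩
  · rw [hde]; exact h.smooth
  · exact (closure_minimal hs isClosed_Icc).trans fun x hx => lt_of_lt_of_le ha hx.1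

theorem exists_isTestFunction_integral_eq_one :
    ∃ χ, IsTestFunction χ ∧ ∫ x in Ioi (0 : ℝ), χ x = 1 := by
  let B : ContDiffBump (2 : ℝ) := ⟨1 / 2, 1, by norm_num, by norm_num⟩
  have hsupp : tsupport (B.normed volume) ⊆ Ioi 0 := by
    rw [B.tsupport_normed_eq, Real.closedBall_eq_Icc]
    intro x hx
    have := hx.1
    simp only [B] at this
    exact mem_Ioi.2 (by linarith)
  refine ⟨fun x => (B.normed volume x : ℂ), ⟨Complex.ofRealCLM.contDiff.comp B.contDiff_normed,
    B.hasCompactSupport_normed.comp_left (g := Complex.ofReal) Complex.ofReal_zero,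
    (tsupport_comp_subset (g := Complex.ofReal) Complex.ofReal_zero _).trans hsupp⟩, ?_⟩
  rw [setIntegral_eq_integral_of_forall_compl_eq_zero, integral_complex_ofReal, B.integral_normed,
    Complex.ofReal_one]
  intro x hx
  have : B.normed volume x = 0 := by
    by_contra hne
    exact hx (hsupp (subset_tsupport _ hne))
  simp [this]

/-- The du Bois-Reymond lemma: a function with vanishing weak derivative is constant. -/
theorem exists_ae_eq_const_of_integral_deriv_mul_eq_zero {w : ℝ → ℂ}
    (hw : LocallyIntegrableOn w (Ioi 0))
    (h : ∀ φ, IsTestFunction φ → ∫ x in Ioi (0 : ℝ), deriv φ x * w x = 0) :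
    ∃ c, w =ᵐ[volume.restrict (Ioi (0 : ℝ))] fun _ => c := by
  obtain ⟨χ, hχ, hχ1⟩ := exists_isTestFunction_integral_eq_one
  have hint : ∀ {η}, IsTestFunction η → Integrable η (volume.restrict (Ioi (0 : ℝ))) := fun hη =>
    (hη.smooth.continuous.integrable_of_hasCompactSupport hη.compactSupport).restrict
  refine ⟨∫ x in Ioi (0 : ℝ), χ x * w x, ?_⟩
  set c := ∫ x in Ioi (0 : ℝ), χ x * w x with hc
  have hwc : LocallyIntegrableOn (fun x => w x - c) (Ioi 0) :=
    hw.sub (continuousOn_const.locallyIntegrableOn measurableSet_Ioi)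
  have key := ae_eq_zero_of_forall_isTestFunction hwc fun η hη => by
    -- `η` minus a multiple of `χ` has integral zero, hence is a derivative
    set s := ∫ x in Ioi (0 : ℝ), η x with hs
    obtain ⟨Φ, hΦ, hΦ'⟩ := (hη.add (hχ.const_smul (-s))).exists_deriv_eq (by
      simp only [Pi.add_apply, Pi.smul_apply, smul_eq_mul]
      rw [integral_add (hint hη) ((hint hχ).const_mul _), integral_const_mul, hχ1]
      ring)
    have := h Φ hΦ
    rw [hΦ'] at this
    simp only [Pi.add_apply, Pi.smul_apply, smul_eq_mul, add_mul, mul_assoc] at this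
    rw [integral_add (hη.integrable_mul_of_locallyIntegrableOn hw).restrict
      ((hχ.integrable_mul_of_locallyIntegrableOn hw).restrict.const_mul _),
      integral_const_mul, ← hc] at this
    simp only [mul_sub]
    rw [integral_sub (hη.integrable_mul_of_locallyIntegrableOn hw).restrict
      ((hint hη).mul_const _), integral_mul_const, ← hs]
    linear_combination this
  filter_upwards [key] with x hx
  exact sub_eq_zero.1 hx

theorem locallyIntegrableOn_L2 (f : L2) : LocallyIntegrableOn f (Ioi 0) :=
  locallyIntegrableOn_of_locallyIntegrable_restrict
    ((Lp.memLp f).locallyIntegrable (by norm_num))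

theorem continuousOn_primitive_L2 (g : L2) :
    ContinuousOn (fun x => ∫ t in (0 : ℝ)..x, g t) (Ici 0) := by
  intro x hx
  have hx : (0 : ℝ) ≤ x := hx
  have h1 := (absolutelyContinuousOnInterval_primitive
    (intervalIntegrable_L2 g le_rfl (by linarith : (0 : ℝ) ≤ x + 1))).continuousOn x
  rw [uIcc_of_le (by linarith)] at h1
  refine (h1 ⟨hx, by linarith⟩).mono_of_mem_nhdsWithin ?_
  rw [← Ici_inter_Iic]
  exact inter_mem self_mem_nhdsWithin (mem_nhdsWithin_of_mem_nhds (Iic_mem_nhds (by linarith)))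

/-- A weakly differentiable function has an absolutely continuous representative. -/
theorem IsWeakDeriv.exists_isPrimitiveOf {f g : L2} (h : IsWeakDeriv f g) :
    ∃ F, IsPrimitiveOf F f g := by
  set G : ℝ → ℂ := fun x => ∫ t in (0 : ℝ)..x, g t with hG
  have hGc : ContinuousOn G (Ici 0) := continuousOn_primitive_L2 g
  have hGl : LocallyIntegrableOn G (Ioi 0) :=
    (hGc.mono Ioi_subset_Ici_self).locallyIntegrableOn measurableSet_Ioi
  have hl : LocallyIntegrableOn (fun x => f x - G x) (Ioi 0) := (locallyIntegrableOn_L2 f).sub hGl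
  obtain ⟨c, hc⟩ := exists_ae_eq_const_of_integral_deriv_mul_eq_zero hl fun φ hφ => by
    obtain ⟨a, b, ha, hab, hsub⟩ := hφ.exists_tsupport_subset_Ico
    have hb : 0 ≤ b := ha.le.trans hab.le
    have hdc : Continuous (deriv φ) := hφ.deriv.smooth.continuous
    have ibp := integral_mul_add_mul_of_primitive (F := G) (V := φ) (v := deriv φ) hb
      (intervalIntegrable_L2 g le_rfl hb) (hdc.intervalIntegrable 0 b)
      (fun x _ => by simp [hG])
      (fun x _ => by
        rw [intervalIntegral.integral_deriv_eq_sub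
          (fun y _ => hφ.smooth.differentiable (by simp) y) (hdc.intervalIntegrable 0 x)]
        ring)
    rw [image_eq_zero_of_notMem_tsupport fun h => lt_irrefl _ (hsub h).2, hφ.eq_zero le_rfl,
      mul_zero, mul_zero, sub_zero,
      intervalIntegral.integral_add
        ((intervalIntegrable_L2 g le_rfl hb).mul_continuousOn hφ.smooth.continuous.continuousOn)
        ((hdc.intervalIntegrable 0 b).continuousOn_mul
          (hGc.mono (by rw [uIcc_of_le hb]; exact Icc_subset_Ici_self)))] at ibp
    have e1 := h φ hφ
    rw [integral_Ioi_eq_of_tsupport_subset _ hb hsub] at e1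
    have e2 := integral_Ioi_eq_of_tsupport_subset G hb (tsupport_deriv_subset.trans hsub)
    simp only [mul_sub]
    rw [integral_sub
      (hφ.deriv.integrable_mul_of_locallyIntegrableOn (locallyIntegrableOn_L2 f)).restrict
      (hφ.deriv.integrable_mul_of_locallyIntegrableOn hGl).restrict, e1, e2]
    simp only [mul_comm (g _), mul_comm (G _)] at ibp
    linear_combination -ibp
  refine ⟨fun x => c + G x, fun x _ => by simp [hG], ?_⟩
  filter_upwards [hc] with x hx
  rw [← hx]; ring

/-! ### Green's identity on the half-line -/

/-- The bilinear pairing `(f, g) ↦ ∫₀^∞ f g` on `L²(ℝ₊)`. -/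
def pairing : L2 →L[ℂ] L2 →L[ℂ] ℂ :=
  (ContinuousLinearMap.mul ℂ ℂ).lpPairing (volume.restrict (Ioi (0 : ℝ))) 2 2

theorem pairing_apply (f g : L2) : pairing f g = ∫ x in Ioi (0 : ℝ), f x * g x := by
  rw [pairing, ContinuousLinearMap.lpPairing_eq_integral]
  rfl

theorem pairing_toLp {φ : ℝ → ℂ} (hφ : MemLp φ 2 (volume.restrict (Ioi (0 : ℝ)))) (f : L2) :
    pairing hφ.toLp f = ∫ x in Ioi (0 : ℝ), φ x * f x := by
  rw [pairing_apply]
  refine integral_congr_ae ?_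
  filter_upwards [hφ.coeFn_toLp] with x hx
  rw [hx]

theorem integrable_mul_L2_L2 (f g : L2) :
    Integrable (fun x => f x * g x) (volume.restrict (Ioi (0 : ℝ))) :=
  (Lp.memLp f).integrable_mul (Lp.memLp g)

theorem IsTestFunction.memLp {φ : ℝ → ℂ} (h : IsTestFunction φ) :
    MemLp φ 2 (volume.restrict (Ioi (0 : ℝ))) :=
  (h.smooth.continuous.memLp_of_hasCompactSupport h.compactSupport).restrict _

theorem isWeakDeriv_iff_pairing {f g : L2} : IsWeakDeriv f g ↔ ∀ φ (h : IsTestFunction φ),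
    pairing h.deriv.memLp.toLp f + pairing h.memLp.toLp g = 0 := by
  simp only [IsWeakDeriv, pairing_toLp, eq_neg_iff_add_eq_zero]

theorem isClosed_setOf_isWeakDeriv : IsClosed {p : L2 × L2 | IsWeakDeriv p.1 p.2} := by
  simp only [isWeakDeriv_iff_pairing, ofPred_forall]
  refine isClosed_iInter fun φ => isClosed_iInter fun h => isClosed_eq ?_ continuous_const
  fun_prop

namespace IsPrimitiveOf

variable {F U : ℝ → ℂ} {f g u v : L2}

theorem continuousOn (h : IsPrimitiveOf F f g) : ContinuousOn F (Ici 0) :=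
  ((continuousOn_const (c := F 0)).add (continuousOn_primitive_L2 g)).congr
    fun x hx => h.eq_integral x hx

theorem integrableOn_mul (h : IsPrimitiveOf F f g) (k : IsPrimitiveOf U u v) :
    IntegrableOn (fun x => g x * U x + F x * v x) (Ioi 0) := by
  refine ((integrable_mul_L2_L2 g u).add (integrable_mul_L2_L2 f v)).congr ?_
  filter_upwards [h.ae_eq, k.ae_eq] with x h1 h2
  rw [Pi.add_apply, h1, h2]

theorem integral_mul_add_mul (h : IsPrimitiveOf F f g) (k : IsPrimitiveOf U u v) {R : ℝ}
    (hR : 0 ≤ R) :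
    ∫ x in (0 : ℝ)..R, (g x * U x + F x * v x) = F R * U R - F 0 * U 0 :=
  integral_mul_add_mul_of_primitive hR (intervalIntegrable_L2 g le_rfl hR)
    (intervalIntegrable_L2 v le_rfl hR) (fun x hx => h.eq_integral x hx.1)
    (fun x hx => k.eq_integral x hx.1)

/-- A function in `H¹(ℝ₊)` vanishes at infinity: its square is integrable and, by
integration by parts, has a limit. -/
theorem tendsto_zero (h : IsPrimitiveOf F f g) : Tendsto F atTop (𝓝 0) := by
  have h1 : Tendsto (fun R => F R * F R) atTop
      (𝓝 ((∫ x in Ioi (0 : ℝ), (g x * F x + F x * g x)) + F 0 * F 0)) := by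
    refine Tendsto.congr' ?_ ((intervalIntegral_tendsto_integral_Ioi 0
      (h.integrableOn_mul h) tendsto_id).add_const (F 0 * F 0))
    filter_upwards [eventually_ge_atTop 0] with R hR
    rw [id, h.integral_mul_add_mul h hR, sub_add_cancel]
  have h2 : IntegrableAtFilter (fun R => F R * F R) atTop := by
    refine ⟨Ioi 0, Ioi_mem_atTop 0, (integrable_mul_L2_L2 f f).congr ?_⟩
    filter_upwards [h.ae_eq] with x hx
    rw [hx]
  have h3 := h2.eq_zero_of_tendsto (fun s hs => by
    obtain ⟨b, hb⟩ := mem_atTop_sets.1 hs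
    rw [← top_le_iff, ← Real.volume_Ici (a := b)]
    exact measure_mono hb) h1
  rw [h3] at h1
  have h4 := h1.norm.sqrt
  simpa [← tendsto_zero_iff_norm_tendsto_zero] using h4

/-- Green's identity: only the boundary term at `0` survives. -/
theorem pairing_add_pairing (h : IsPrimitiveOf F f g) (k : IsPrimitiveOf U u v) :
    pairing g u + pairing f v = -(F 0 * U 0) := by
  have h1 := intervalIntegral_tendsto_integral_Ioi 0 (h.integrableOn_mul k) tendsto_id
  have h2 : Tendsto (fun R => F R * U R - F 0 * U 0) atTop (𝓝 (0 * 0 - F 0 * U 0)) :=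
    (h.tendsto_zero.mul k.tendsto_zero).sub_const _
  have h3 := tendsto_nhds_unique (h1.congr' (by
    filter_upwards [eventually_ge_atTop 0] with R hR
    exact h.integral_mul_add_mul k hR)) h2
  rw [zero_mul, zero_sub] at h3
  rw [← h3, pairing_apply, pairing_apply, ← integral_add (integrable_mul_L2_L2 g u)
    (integrable_mul_L2_L2 f v)]
  refine integral_congr_ae ?_
  filter_upwards [h.ae_eq, k.ae_eq] with x h1 h2
  rw [h1, h2]

theorem apply_zero_eq (h : IsPrimitiveOf F f g) {c : ℂ} (hc : HasBoundaryValue f c) : F 0 = c := by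
  obtain ⟨w, h1, rfl, h3⟩ := hc
  have h4 : F =ᵐ[volume.restrict (Ici (0 : ℝ))] w := by
    rw [← restrict_Ioi_eq_restrict_Ici]
    exact h.ae_eq.symm.trans h3
  exact Measure.eqOn_of_ae_eq h4 h.continuousOn h1
    (by rw [interior_Ici, closure_Ioi]) self_mem_Ici

theorem hasBoundaryValue (h : IsPrimitiveOf F f g) : HasBoundaryValue f (F 0) :=
  ⟨F, h.continuousOn, rfl, h.ae_eq⟩

end IsPrimitiveOf

theorem memLp_exp_neg : MemLp (fun x : ℝ => (Real.exp (-x) : ℂ)) 2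
    (volume.restrict (Ioi (0 : ℝ))) := by
  rw [memLp_two_iff_integrable_sq_norm (by fun_prop)]
  refine (integrableOn_exp_mul_Ioi (a := -2) (by norm_num) 0).congr
    (Eventually.of_forall fun x => ?_)
  beta_reduce
  rw [Complex.norm_real, Real.norm_of_nonneg (Real.exp_pos _).le, ← Real.exp_nat_mul]
  norm_num

theorem isPrimitiveOf_toLp {φ φ' : ℝ → ℂ} (hφ : MemLp φ 2 (volume.restrict (Ioi (0 : ℝ))))
    (hφ' : MemLp φ' 2 (volume.restrict (Ioi (0 : ℝ)))) (hd : ∀ x, HasDerivAt φ (φ' x) x)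
    (hc : Continuous φ') : IsPrimitiveOf φ hφ.toLp hφ'.toLp where
  ae_eq := hφ.coeFn_toLp
  eq_integral x hx := by
    have h1 : ∫ t in (0 : ℝ)..x, (hφ'.toLp : L2) t = ∫ t in (0 : ℝ)..x, φ' t := by
      refine intervalIntegral.integral_congr_ae ?_
      filter_upwards [(ae_restrict_iff' measurableSet_Ioi).1 hφ'.coeFn_toLp] with t ht ht'
      rw [uIoc_of_le hx] at ht'
      exact ht ht'.1
    rw [h1, intervalIntegral.integral_eq_sub_of_hasDerivAt (fun t _ => hd t)
      (hc.intervalIntegrable _ _)]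
    ring

theorem isPrimitiveOf_exp_neg : IsPrimitiveOf (fun x => (Real.exp (-x) : ℂ))
    memLp_exp_neg.toLp memLp_exp_neg.neg.toLp := by
  refine isPrimitiveOf_toLp _ _ (fun t => ?_) (by fun_prop)
  have := ((hasDerivAt_neg t).exp).ofReal_comp
  simpa using this

theorem IsTestFunction.isPrimitiveOf {φ : ℝ → ℂ} (h : IsTestFunction φ) :
    IsPrimitiveOf φ h.memLp.toLp h.deriv.memLp.toLp :=
  isPrimitiveOf_toLp _ _ (fun x => (h.smooth.differentiable (by simp) x).hasDerivAt)
    h.deriv.smooth.continuous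

theorem pairing_comm (f g : L2) : pairing f g = pairing g f := by
  simp only [pairing_apply, mul_comm]

theorem IsPrimitiveOf.isWeakDeriv {F : ℝ → ℂ} {f g : L2} (h : IsPrimitiveOf F f g) :
    IsWeakDeriv f g := by
  refine isWeakDeriv_iff_pairing.2 fun φ hφ => ?_
  have := hφ.isPrimitiveOf.pairing_add_pairing h
  rwa [hφ.eq_zero le_rfl, zero_mul, neg_zero] at this

theorem IsWeakDeriv.unique {f g g' : L2} (h : IsWeakDeriv f g) (h' : IsWeakDeriv f g') :
    g = g' := by
  have h1 := h.add (h'.smul (-1))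
  rw [neg_one_smul, add_neg_cancel, neg_one_smul, ← sub_eq_add_neg] at h1
  exact sub_eq_zero.1 h1.eq_zero

/-- The pairs `(φ, φ')` with `φ` a test function, whose closure is the graph of the
weak derivative on `H¹₀(ℝ₊)`. -/
def testPairs : Set (L2 × L2) := {p | ∃ φ : ℝ → ℂ, IsTestFunction φ ∧
  p.1 =ᵐ[volume.restrict (Ioi (0 : ℝ))] φ ∧ p.2 =ᵐ[volume.restrict (Ioi (0 : ℝ))] deriv φ}

theorem mem_testPairs {p : L2 × L2} : p ∈ testPairs ↔
    ∃ φ, ∃ h : IsTestFunction φ, p = (h.memLp.toLp, h.deriv.memLp.toLp) := by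
  constructor
  · rintro ⟨φ, hφ, h1, h2⟩
    exact ⟨φ, hφ, Prod.ext (Lp.ext (h1.trans hφ.memLp.coeFn_toLp.symm))
      (Lp.ext (h2.trans hφ.deriv.memLp.coeFn_toLp.symm))⟩
  · rintro ⟨φ, hφ, rfl⟩
    exact ⟨φ, hφ, hφ.memLp.coeFn_toLp, hφ.deriv.memLp.coeFn_toLp⟩

theorem isWeakDeriv_of_mem_closure_testPairs {f g : L2} (h : (f, g) ∈ closure testPairs) :
    IsWeakDeriv f g := by
  refine closure_minimal (fun p hp => ?_) isClosed_setOf_isWeakDeriv h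
  obtain ⟨φ, hφ, rfl⟩ := mem_testPairs.1 hp
  exact hφ.isPrimitiveOf.isWeakDeriv

theorem pairing_add_pairing_of_mem_closure_testPairs {f g u v : L2}
    (h : (f, g) ∈ closure testPairs) (k : IsWeakDeriv u v) : pairing g u + pairing f v = 0 := by
  have c1 : Continuous fun p : L2 × L2 => pairing p.2 u :=
    (pairing.continuous.comp continuous_snd).clm_apply continuous_const
  have c2 : Continuous fun p : L2 × L2 => pairing p.1 v :=
    (pairing.continuous.comp continuous_fst).clm_apply continuous_const
  have hc : IsClosed {p : L2 × L2 | pairing p.2 u + pairing p.1 v = 0} :=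
    isClosed_eq (c1.add c2) continuous_const
  have hsub : testPairs ⊆ {p : L2 × L2 | pairing p.2 u + pairing p.1 v = 0} := by
    intro p hp
    obtain ⟨φ, hφ, rfl⟩ := mem_testPairs.1 hp
    rw [mem_ofPred_eq]
    exact isWeakDeriv_iff_pairing.1 k φ hφ
  have := closure_minimal hsub hc h
  rwa [mem_ofPred_eq] at this

/-- The trace at `0` of a function in `H¹₀(ℝ₊)` vanishes, by Green's identity
against `exp (-x)`. -/
theorem IsPrimitiveOf.apply_zero_of_memH10 {F : ℝ → ℂ} {f g : L2} (hF : IsPrimitiveOf F f g)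
    (h : MemH10 f) : F 0 = 0 := by
  obtain ⟨g', hg'⟩ := h
  obtain rfl := hF.isWeakDeriv.unique (isWeakDeriv_of_mem_closure_testPairs hg')
  have h1 := pairing_add_pairing_of_mem_closure_testPairs hg' isPrimitiveOf_exp_neg.isWeakDeriv
  rw [hF.pairing_add_pairing isPrimitiveOf_exp_neg] at h1
  simpa using h1

/-! ### Density of test functions -/

theorem IsTestFunction.conj {φ : ℝ → ℂ} (h : IsTestFunction φ) :
    IsTestFunction fun x => starRingEnd ℂ (φ x) where
  smooth := Complex.conjCLE.contDiff.comp h.smooth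
  compactSupport := h.compactSupport.comp_left (g := starRingEnd ℂ) (map_zero _)
  support_subset :=
    (tsupport_comp_subset (g := starRingEnd ℂ) (map_zero _) φ).trans h.support_subset

theorem inner_eq_integral (f g : L2) :
    ⟪f, g⟫_ℂ = ∫ x in Ioi (0 : ℝ), starRingEnd ℂ (f x) * g x := by
  rw [L2.inner_def]
  simp only [RCLike.inner_apply, mul_comm]

theorem inner_toLp {φ : ℝ → ℂ} (hφ : MemLp φ 2 (volume.restrict (Ioi (0 : ℝ)))) (f : L2) :
    ⟪hφ.toLp, f⟫_ℂ = ∫ x in Ioi (0 : ℝ), starRingEnd ℂ (φ x) * f x := by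
  rw [inner_eq_integral]
  refine integral_congr_ae ?_
  filter_upwards [hφ.coeFn_toLp] with x hx
  rw [hx]

theorem IsTestFunction.inner_conj_toLp {φ : ℝ → ℂ} (h : IsTestFunction φ) (f : L2) :
    ⟪h.conj.memLp.toLp, f⟫_ℂ = ∫ x in Ioi (0 : ℝ), φ x * f x := by
  simp only [inner_toLp, Complex.conj_conj]

/-- The classes of test functions in `L²(ℝ₊)`. -/
def testFunctions : Submodule ℂ L2 where
  carrier := {f | ∃ φ, ∃ h : IsTestFunction φ, f = h.memLp.toLp}
  zero_mem' := ⟨0, IsTestFunction.zero, rfl⟩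
  add_mem' := by
    rintro _ _ ⟨φ, h, rfl⟩ ⟨χ, k, rfl⟩
    exact ⟨φ + χ, h.add k, rfl⟩
  smul_mem' := by
    rintro c _ ⟨φ, h, rfl⟩
    exact ⟨c • φ, h.const_smul c, rfl⟩

theorem IsTestFunction.toLp_mem {φ : ℝ → ℂ} (h : IsTestFunction φ) :
    h.memLp.toLp ∈ testFunctions := ⟨φ, h, rfl⟩

theorem dense_testFunctions : Dense (testFunctions : Set L2) := by
  rw [Submodule.dense_iff_topologicalClosure_eq_top, Submodule.topologicalClosure_eq_top_iff,
    Submodule.eq_bot_iff]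
  intro f hf
  rw [Lp.eq_zero_iff_ae_eq_zero]
  refine ae_eq_zero_of_forall_isTestFunction (locallyIntegrableOn_L2 f) fun φ hφ => ?_
  rw [← hφ.inner_conj_toLp]
  exact (Submodule.mem_orthogonal _ f).1 hf _ hφ.conj.toLp_mem

theorem IsTestFunction.integrable {φ : ℝ → ℂ} (h : IsTestFunction φ) :
    Integrable φ (volume.restrict (Ioi (0 : ℝ))) :=
  (h.smooth.continuous.integrable_of_hasCompactSupport h.compactSupport).restrict

theorem integrable_of_mem_testFunctions {f : L2} (h : f ∈ testFunctions) :
    Integrable f (volume.restrict (Ioi (0 : ℝ))) := by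
  obtain ⟨φ, hφ, rfl⟩ := h
  exact hφ.integrable.congr hφ.memLp.coeFn_toLp.symm

theorem clm_ext_of_testFunctions {T S : L2 →L[ℂ] L2} (h : ∀ f ∈ testFunctions, T f = S f) :
    T = S := by
  ext1 f
  exact congrFun (Continuous.ext_on dense_testFunctions T.continuous S.continuous h) f

/-! ### Unitarity of the Fourier-sine and Fourier-cosine transforms -/

/-- Two operators given on integrable functions by bounded kernels that are conjugate transposes
of each other are adjoint. -/
theorem adjoint_eq_of_kernel {T S : L2 →L[ℂ] L2} {K : ℝ → ℝ → ℂ} {C : ℝ}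
    (hK : Continuous (Function.uncurry K)) (hC : ∀ k x, ‖K k x‖ ≤ C)
    (hT : ∀ ψ : L2, Integrable ψ (volume.restrict (Ioi (0 : ℝ))) →
      T ψ =ᵐ[volume.restrict (Ioi (0 : ℝ))] fun k => ∫ x in Ioi (0 : ℝ), K k x * ψ x)
    (hS : ∀ ψ : L2, Integrable ψ (volume.restrict (Ioi (0 : ℝ))) →
      S ψ =ᵐ[volume.restrict (Ioi (0 : ℝ))]
        fun x => ∫ k in Ioi (0 : ℝ), starRingEnd ℂ (K k x) * ψ k) :
    ContinuousLinearMap.adjoint T = S := by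
  refine clm_ext_of_testFunctions fun φ hφ => ?_
  have hφi := integrable_of_mem_testFunctions hφ
  refine dense_testFunctions.eq_of_inner_left (𝕜 := ℂ) fun ψ hψ => ?_
  have hψi := integrable_of_mem_testFunctions hψ
  rw [ContinuousLinearMap.adjoint_inner_left]
  rw [inner_eq_integral, inner_eq_integral]
  calc ∫ k in Ioi (0 : ℝ), starRingEnd ℂ (φ k) * T ψ k
      = ∫ k in Ioi (0 : ℝ), ∫ x in Ioi (0 : ℝ), K k x * (starRingEnd ℂ (φ k) * ψ x) := by
        refine integral_congr_ae ?_
        filter_upwards [hT ψ hψi] with k hk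
        rw [hk, ← integral_const_mul]
        refine integral_congr_ae (Eventually.of_forall fun x => ?_)
        ring
    _ = ∫ x in Ioi (0 : ℝ), ∫ k in Ioi (0 : ℝ), K k x * (starRingEnd ℂ (φ k) * ψ x) := by
        refine integral_integral_swap ?_
        have h1 : Integrable (fun k => starRingEnd ℂ (φ k)) (volume.restrict (Ioi (0 : ℝ))) :=
          Complex.conjCLE.toContinuousLinearMap.integrable_comp hφi
        exact (h1.mul_prod hψi).bdd_mul (c := C) hK.aestronglyMeasurable
          (Eventually.of_forall fun p => hC p.1 p.2)
    _ = ∫ x in Ioi (0 : ℝ), starRingEnd ℂ (S φ x) * ψ x := by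
        refine integral_congr_ae ?_
        filter_upwards [hS φ hφi] with x hx
        rw [hx, ← integral_conj, ← integral_mul_const]
        refine integral_congr_ae (Eventually.of_forall fun k => ?_)
        simp only [map_mul, Complex.conj_conj]
        ring

theorem adjoint_cosineTransform : ContinuousLinearMap.adjoint cosineTransform = cosineTransform := by
  refine adjoint_eq_of_kernel (K := fun k x => (2 / √(2 * Real.pi) : ℂ) * (Real.cos (k * x) : ℂ))
    (C := ‖(2 / √(2 * Real.pi) : ℂ)‖) (by fun_prop) (fun k x => ?_) (fun ψ hψ => ?_)
    (fun ψ hψ => ?_)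
  · rw [norm_mul, Complex.norm_real]
    exact mul_le_of_le_one_right (norm_nonneg _) (Real.abs_cos_le_one _)
  · simpa only [mul_assoc, integral_const_mul] using cosineTransform_ae_eq ψ hψ
  · simpa only [map_mul, map_div₀, Complex.conj_ofReal, map_ofNat, mul_assoc, integral_const_mul,
      mul_comm (_ : ℝ) _] using cosineTransform_ae_eq ψ hψ

theorem adjoint_sineTransform : ContinuousLinearMap.adjoint sineTransform = -sineTransform := by
  refine adjoint_eq_of_kernel
    (K := fun k x => -(2 * Complex.I / √(2 * Real.pi)) * (Real.sin (k * x) : ℂ))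
    (C := ‖-(2 * Complex.I / √(2 * Real.pi))‖) (by fun_prop) (fun k x => ?_) (fun ψ hψ => ?_)
    (fun ψ hψ => ?_)
  · rw [norm_mul, Complex.norm_real]
    exact mul_le_of_le_one_right (norm_nonneg _) (Real.abs_sin_le_one _)
  · simpa only [mul_assoc, integral_const_mul] using sineTransform_ae_eq ψ hψ
  · rw [neg_apply]
    filter_upwards [sineTransform_ae_eq ψ hψ, Lp.coeFn_neg (sineTransform ψ)] with x h1 h2
    rw [h2, Pi.neg_apply, h1, ← neg_mul, ← integral_const_mul]
    refine integral_congr_ae (Eventually.of_forall fun k => ?_)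
    simp only [map_mul, map_neg, map_div₀, Complex.conj_ofReal, map_ofNat, Complex.conj_I,
      mul_comm k x]
    ring

theorem norm_fourierLine (f : L2Line) : ‖fourierLine f‖ = ‖f‖ := by
  have h : fourierLine f = ((√(2 * Real.pi))⁻¹ : ℂ) •
      (memLp_dilation (Lp.fourierTransformₗᵢ ℝ ℂ f)).toLp := rfl
  rw [h, norm_smul, norm_dilation, LinearIsometryEquiv.norm_map, norm_inv, Complex.norm_real,
    Real.norm_of_nonneg (Real.sqrt_nonneg _), ← mul_assoc, inv_mul_cancel₀ (by positivity),
    one_mul]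

theorem fourierLine_parity (f : L2Line) : fourierLine (parity f) = parity (fourierLine f) := by
  refine congrFun (Continuous.ext_on
    (SchwartzMap.denseRange_toLpCLM (p := 2) (F := ℂ) (E := ℝ) (μ := volume) ENNReal.ofNat_ne_top)
    (fourierLine.continuous.comp parity.continuous)
    (parity.continuous.comp fourierLine.continuous) ?_) f
  rintro _ ⟨s, rfl⟩
  set g : L2Line := SchwartzMap.toLpCLM ℝ ℂ 2 volume s with hg
  have hgi : Integrable g := s.integrable.congr (s.coeFn_toLp 2 volume).symm
  have hpi : Integrable (parity g) := hgi.comp_neg.congr (parity_ae_eq g).symm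
  refine Lp.ext ?_
  filter_upwards [fourierLine_ae_eq _ hpi, parity_ae_eq (fourierLine g),
    (Measure.measurePreserving_neg (volume : Measure ℝ)).quasiMeasurePreserving.ae_eq_comp
      (fourierLine_ae_eq g hgi)] with k h1 h2 h3
  simp only [Function.comp_apply] at h1 h2 h3 ⊢
  rw [h1, h2, h3]
  congr 1
  rw [← integral_neg_eq_self]
  refine integral_congr_ae ?_
  have h4 := (Measure.measurePreserving_neg (volume : Measure ℝ)).quasiMeasurePreserving.ae_eq_comp
      (parity_ae_eq g)
  filter_upwards [h4] with x hx
  simp only [Function.comp_apply, neg_neg] at hx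
  rw [hx, mul_neg, neg_mul k x]

theorem parity_parity (f : L2Line) : parity (parity f) = f := by
  refine Lp.ext ?_
  have h4 := (Measure.measurePreserving_neg (volume : Measure ℝ)).quasiMeasurePreserving.ae_eq_comp
      (parity_ae_eq f)
  filter_upwards [parity_ae_eq (parity f), h4] with x h1 h2
  simp only [Function.comp_apply, neg_neg] at h2
  rw [h1, h2]

theorem restrict_extend (ψ : L2) : restrict (extend ψ) = ψ := by
  refine Lp.ext ?_
  filter_upwards [LpToLpRestrictCLM_coeFn ℂ (Ioi 0) (extend ψ), ae_restrict_of_ae (extend_ae_eq ψ),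
    ae_restrict_mem measurableSet_Ioi] with x h1 h2 h3
  rw [restrict, h1, h2, indicator_of_mem h3]

theorem restrict_parity_extend (ψ : L2) : restrict (parity (extend ψ)) = 0 := by
  refine Lp.ext ?_
  have h4 := (Measure.measurePreserving_neg (volume : Measure ℝ)).quasiMeasurePreserving.ae_eq_comp
      (extend_ae_eq ψ)
  filter_upwards [LpToLpRestrictCLM_coeFn ℂ (Ioi 0) (parity (extend ψ)),
    ae_restrict_of_ae (parity_ae_eq (extend ψ)), ae_restrict_of_ae h4,
    ae_restrict_mem measurableSet_Ioi, Lp.coeFn_zero ℂ 2 (volume.restrict (Ioi (0 : ℝ)))]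
    with x h1 h2 h3 h5 h6
  have h5 : 0 < x := h5
  simp only [Function.comp_apply] at h3
  rw [restrict, h1, h2, h3, h6, indicator_of_notMem (by simpa using h5.le), Pi.zero_apply]

theorem norm_sq_eq_integral {μ : Measure ℝ} (f : Lp ℂ 2 μ) : ‖f‖ ^ 2 = ∫ x, ‖f x‖ ^ 2 ∂μ := by
  have h := L2.inner_def (𝕜 := ℂ) f f
  simp only [inner_self_eq_norm_sq_to_K] at h
  have h2 : ((‖f‖ ^ 2 : ℝ) : ℂ) = ((∫ x, ‖f x‖ ^ 2 ∂μ : ℝ) : ℂ) := by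
    rw [← integral_complex_ofReal]
    push_cast
    exact h
  exact_mod_cast h2

theorem norm_sq_restrict_add (g : L2Line) :
    ‖g‖ ^ 2 = ‖restrict g‖ ^ 2 + ‖restrict (parity g)‖ ^ 2 := by
  have hi : Integrable (fun x => ‖g x‖ ^ 2) := (Lp.memLp g).integrable_norm_pow (by norm_num)
  rw [norm_sq_eq_integral, norm_sq_eq_integral, norm_sq_eq_integral]
  have e1 : ∫ x in Ioi (0 : ℝ), ‖restrict g x‖ ^ 2 = ∫ x in Ioi (0 : ℝ), ‖g x‖ ^ 2 := by
    refine integral_congr_ae ?_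
    filter_upwards [LpToLpRestrictCLM_coeFn ℂ (Ioi 0) g] with x hx
    rw [restrict, hx]
  have e2 : ∫ x in Ioi (0 : ℝ), ‖restrict (parity g) x‖ ^ 2 = ∫ x in Iic (0 : ℝ), ‖g x‖ ^ 2 := by
    have e3 := integral_comp_neg_Ioi (0 : ℝ) (fun x => ‖g x‖ ^ 2)
    rw [neg_zero] at e3
    rw [← e3]
    refine integral_congr_ae ?_
    filter_upwards [LpToLpRestrictCLM_coeFn ℂ (Ioi 0) (parity g),
      ae_restrict_of_ae (parity_ae_eq g)] with x hx hx'
    rw [restrict, hx, hx']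
  rw [e1, e2, add_comm, ← setIntegral_union (by simp) measurableSet_Ioi hi.integrableOn
    hi.integrableOn]
  simp

/-- On functions of definite parity, the Fourier transform on the line restricts to an isometry of
the half-line. -/
theorem norm_restrict_fourierLine (ψ : L2) {s : ℂ} (hs : s * s = 1) :
    ‖restrict (fourierLine (extend ψ + s • parity (extend ψ)))‖ = ‖ψ‖ := by
  set f := extend ψ + s • parity (extend ψ) with hf
  have hn : ‖s‖ = 1 := by
    have : ‖s‖ * ‖s‖ = 1 := by rw [← norm_mul, hs, norm_one]
    nlinarith [norm_nonneg s]
  have hp : parity f = s • f := by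
    rw [hf, map_add, map_smul, parity_parity, smul_add, smul_smul, hs, one_smul, add_comm]
  have hr : restrict f = ψ := by
    rw [hf, map_add, map_smul, restrict_extend, restrict_parity_extend, smul_zero, add_zero]
  have h1 := norm_sq_restrict_add f
  have h2 := norm_sq_restrict_add (fourierLine f)
  rw [← fourierLine_parity, hp, map_smul, map_smul, norm_smul, hn, one_mul, norm_fourierLine] at h2
  rw [hp, map_smul, norm_smul, hn, one_mul, hr] at h1
  have h3 : ‖restrict (fourierLine f)‖ ^ 2 = ‖ψ‖ ^ 2 := by linarith
  exact (pow_left_inj₀ (norm_nonneg _) (norm_nonneg _) two_ne_zero).1 h3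

theorem norm_sineTransform (ψ : L2) : ‖sineTransform ψ‖ = ‖ψ‖ := by
  have h := norm_restrict_fourierLine ψ (s := -1) (by norm_num)
  rw [neg_one_smul, ← sub_eq_add_neg] at h
  exact h

theorem norm_cosineTransform (ψ : L2) : ‖cosineTransform ψ‖ = ‖ψ‖ := by
  have h := norm_restrict_fourierLine ψ (s := 1) (by norm_num)
  rw [one_smul] at h
  exact h

theorem sineTransform_mem_unitary : sineTransform ∈ unitary (L2 →L[ℂ] L2) := by
  have h : star sineTransform * sineTransform = 1 :=
    (ContinuousLinearMap.norm_map_iff_adjoint_comp_self sineTransform).1 norm_sineTransform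
  refine Unitary.mem_iff.2 ⟨h, ?_⟩
  have e : star sineTransform = -sineTransform := adjoint_sineTransform
  rw [e] at h ⊢
  rw [← h]; simp

theorem cosineTransform_mem_unitary : cosineTransform ∈ unitary (L2 →L[ℂ] L2) := by
  have h : star cosineTransform * cosineTransform = 1 :=
    (ContinuousLinearMap.norm_map_iff_adjoint_comp_self cosineTransform).1 norm_cosineTransform
  refine Unitary.mem_iff.2 ⟨h, ?_⟩
  have e : star cosineTransform = cosineTransform := adjoint_cosineTransform
  rwa [e] at h ⊢

/-! ### Sine and cosine transforms of derivatives -/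

theorem tendsto_L2_of_dominated {ι : Type*} {l : Filter ι} [l.IsCountablyGenerated] {F : ι → L2}
    {f : L2} {Φ : ι → ℝ → ℂ} {G : ℝ → ℝ} (hG : Integrable G (volume.restrict (Ioi (0 : ℝ))))
    (hF : ∀ i, F i =ᵐ[volume.restrict (Ioi (0 : ℝ))] Φ i)
    (hb : ∀ᶠ i in l, ∀ᵐ x ∂volume.restrict (Ioi (0 : ℝ)), ‖Φ i x - f x‖ ^ 2 ≤ G x)
    (hlim : ∀ᵐ x ∂volume.restrict (Ioi (0 : ℝ)), Tendsto (fun i => Φ i x) l (𝓝 (f x))) :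
    Tendsto F l (𝓝 f) := by
  rw [tendsto_iff_norm_sub_tendsto_zero]
  have h1 : Tendsto (fun i => ∫ x in Ioi (0 : ℝ), ‖Φ i x - f x‖ ^ 2) l
      (𝓝 (∫ x in Ioi (0 : ℝ), (0 : ℝ))) := by
    refine tendsto_integral_filter_of_dominated_convergence G
      (Eventually.of_forall fun i => ?_) ?_ hG ?_
    · exact (((Lp.aestronglyMeasurable (F i)).congr (hF i)).sub
        (Lp.aestronglyMeasurable f)).norm.pow 2
    · filter_upwards [hb] with i hi
      filter_upwards [hi] with x hx
      rwa [Real.norm_of_nonneg (by positivity)]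
    · filter_upwards [hlim] with x hx
      simpa using ((hx.sub_const (f x)).norm.pow 2)
  have h2 : ∀ i, ‖F i - f‖ = √(∫ x in Ioi (0 : ℝ), ‖Φ i x - f x‖ ^ 2) := by
    intro i
    rw [← Real.sqrt_sq (norm_nonneg (F i - f)), norm_sq_eq_integral]
    congr 1
    refine integral_congr_ae ?_
    filter_upwards [hF i, Lp.coeFn_sub (F i) f] with x h1 h2
    rw [h2, Pi.sub_apply, h1]
  simp only [h2]
  simpa using h1.sqrt

theorem exists_subseq_ae_tendsto {f g : ℕ → L2} {f₀ g₀ : L2} (hf : Tendsto f atTop (𝓝 f₀))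
    (hg : Tendsto g atTop (𝓝 g₀)) : ∃ ns : ℕ → ℕ, Tendsto ns atTop atTop ∧
    ∀ᵐ x ∂volume.restrict (Ioi (0 : ℝ)), Tendsto (fun i => f (ns i) x) atTop (𝓝 (f₀ x)) ∧
      Tendsto (fun i => g (ns i) x) atTop (𝓝 (g₀ x)) := by
  obtain ⟨n1, h1, h1'⟩ := (tendstoInMeasure_of_tendsto_Lp hf).exists_seq_tendsto_ae
  obtain ⟨n2, h2, h2'⟩ := (tendstoInMeasure_of_tendsto_Lp
    (hg.comp h1.tendsto_atTop)).exists_seq_tendsto_ae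
  refine ⟨n1 ∘ n2, h1.tendsto_atTop.comp h2.tendsto_atTop, ?_⟩
  filter_upwards [h1', h2'] with x hx hx'
  exact ⟨hx.comp h2.tendsto_atTop, hx'⟩

/-- The truncation of `f ∈ L²(ℝ₊)` to `(0, n]`. -/
def truncate (f : L2) (n : ℕ) : L2 :=
  ((Lp.memLp f).indicator (measurableSet_Iic (a := (n : ℝ)))).toLp

theorem truncate_ae_eq (f : L2) (n : ℕ) :
    truncate f n =ᵐ[volume.restrict (Ioi (0 : ℝ))] (Iic (n : ℝ)).indicator f :=
  MemLp.coeFn_toLp _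

theorem tendsto_truncate (f : L2) : Tendsto (truncate f) atTop (𝓝 f) := by
  refine tendsto_L2_of_dominated (G := fun x => ‖f x‖ ^ 2)
    ((Lp.memLp f).integrable_norm_pow (by norm_num)) (truncate_ae_eq f)
    (Eventually.of_forall fun n => Eventually.of_forall fun x => ?_)
    (Eventually.of_forall fun x => ?_)
  · by_cases h : x ∈ Iic (n : ℝ)
    · rw [indicator_of_mem h, sub_self]; simp
    · rw [indicator_of_notMem h, zero_sub, norm_neg]
  · refine tendsto_const_nhds.congr' ?_
    filter_upwards [eventually_ge_atTop ⌈x⌉₊] with n hn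
    rw [indicator_of_mem]
    exact mem_Iic.2 ((Nat.le_ceil x).trans (by exact_mod_cast hn))

theorem integral_mul_truncate (f : L2) (n : ℕ) (w : ℝ → ℂ) :
    ∫ x in Ioi (0 : ℝ), w x * truncate f n x = ∫ x in (0 : ℝ)..n, w x * f x := by
  rw [intervalIntegral.integral_of_le n.cast_nonneg, ← Ioi_inter_Iic,
    ← setIntegral_indicator measurableSet_Iic]
  refine integral_congr_ae ?_
  filter_upwards [truncate_ae_eq f n] with x hx
  rw [hx, indicator_mul_right]

theorem integrable_truncate (f : L2) (n : ℕ) :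
    Integrable (truncate f n) (volume.restrict (Ioi (0 : ℝ))) := by
  refine Integrable.congr ?_ (truncate_ae_eq f n).symm
  rw [integrable_indicator_iff measurableSet_Iic, IntegrableOn,
    Measure.restrict_restrict measurableSet_Iic, inter_comm, Ioi_inter_Iic]
  exact integrableOn_L2 f le_rfl

/-- Integration by parts on `[0, n]` against a smooth function. -/
theorem IsPrimitiveOf.integral_mul_truncate {F : ℝ → ℂ} {f g : L2} (h : IsPrimitiveOf F f g)
    {w w' : ℝ → ℂ} (hw : ∀ x, HasDerivAt w (w' x) x) (hw' : Continuous w') (n : ℕ) :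
    ∫ x in Ioi (0 : ℝ), w x * truncate g n x
      = F n * w n - F 0 * w 0 - ∫ x in Ioi (0 : ℝ), w' x * truncate f n x := by
  have hn : (0 : ℝ) ≤ n := n.cast_nonneg
  have hwc : Continuous w := continuous_iff_continuousAt.2 fun x => (hw x).continuousAt
  rw [HalfLine.integral_mul_truncate, HalfLine.integral_mul_truncate,
    ← integral_mul_add_mul_of_primitive hn (intervalIntegrable_L2 g le_rfl hn)
      (hw'.intervalIntegrable 0 n) (fun x hx => h.eq_integral x hx.1) (fun x _ => by
        rw [intervalIntegral.integral_eq_sub_of_hasDerivAt (fun y _ => hw y)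
          (hw'.intervalIntegrable 0 x)]
        ring)]
  have hFc : ContinuousOn F (uIcc 0 (n : ℝ)) :=
    h.continuousOn.mono (by rw [uIcc_of_le hn]; exact Icc_subset_Ici_self)
  rw [intervalIntegral.integral_add
    ((intervalIntegrable_L2 g le_rfl hn).mul_continuousOn hwc.continuousOn)
    ((hw'.intervalIntegrable 0 n).continuousOn_mul hFc)]
  have e1 : ∫ x in (0 : ℝ)..n, w' x * f x = ∫ x in (0 : ℝ)..n, F x * w' x := by
    refine intervalIntegral.integral_congr_ae ?_
    filter_upwards [(ae_restrict_iff' measurableSet_Ioi).1 h.ae_eq] with x hx hx'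
    rw [uIoc_of_le hn] at hx'
    rw [hx hx'.1, mul_comm]
  rw [e1]
  simp only [mul_comm (w _)]
  ring

/-- A relation between `T g` and `S f` that holds for all truncations up to a boundary term `b n`
tending to zero holds in the limit, along an a.e. convergent subsequence. -/
theorem ae_eq_of_truncate {T S : L2 →L[ℂ] L2} {f g : L2} {m : ℝ → ℂ} {b : ℕ → ℝ → ℂ}
    (hb : ∀ k, Tendsto (fun n => b n k) atTop (𝓝 0))
    (h : ∀ n, T (truncate g n) =ᵐ[volume.restrict (Ioi (0 : ℝ))]
      fun k => b n k + m k * S (truncate f n) k) :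
    T g =ᵐ[volume.restrict (Ioi (0 : ℝ))] fun k => m k * S f k := by
  obtain ⟨ns, hns, hae⟩ := exists_subseq_ae_tendsto
    ((T.continuous.tendsto g).comp (tendsto_truncate g))
    ((S.continuous.tendsto f).comp (tendsto_truncate f))
  filter_upwards [hae, ae_all_iff.2 h] with k hk hk'
  refine tendsto_nhds_unique hk.1 ?_
  have := ((hb k).comp hns).add (hk.2.const_mul (m k))
  rw [zero_add] at this
  refine this.congr fun i => ?_
  exact (hk' (ns i)).symm

/-- The sine transform of a derivative. -/
theorem IsPrimitiveOf.sineTransform_ae_eq {F : ℝ → ℂ} {f g : L2} (h : IsPrimitiveOf F f g) :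
    sineTransform g =ᵐ[volume.restrict (Ioi (0 : ℝ))]
      fun k => (Complex.I * k) * cosineTransform f k := by
  refine ae_eq_of_truncate
    (b := fun n k => -(2 * Complex.I / √(2 * Real.pi)) * (F n * (Real.sin (k * n) : ℂ)))
    (fun k => ?_) fun n => ?_
  · have h1 : Tendsto (fun n : ℕ => F n) atTop (𝓝 0) :=
      h.tendsto_zero.comp tendsto_natCast_atTop_atTop
    have h2 : Tendsto (fun n : ℕ => F n * (Real.sin (k * n) : ℂ)) atTop (𝓝 0) := by
      refine squeeze_zero_norm (fun n => ?_) (tendsto_zero_iff_norm_tendsto_zero.1 h1)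
      rw [norm_mul, Complex.norm_real]
      exact mul_le_of_le_one_right (norm_nonneg _) (Real.abs_sin_le_one _)
    simpa using h2.const_mul (-(2 * Complex.I / √(2 * Real.pi)))
  · filter_upwards [HalfLine.sineTransform_ae_eq _ (integrable_truncate g n),
      HalfLine.cosineTransform_ae_eq _ (integrable_truncate f n)] with k h1 h2
    rw [h1, h2, h.integral_mul_truncate (w := fun x => (Real.sin (k * x) : ℂ))
      (w' := fun x => (k : ℂ) * (Real.cos (k * x) : ℂ)) (fun x => ?_) (by fun_prop)]
    · simp only [mul_zero, Real.sin_zero, Complex.ofReal_zero, mul_assoc, integral_const_mul]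
      ring
    · have := (((hasDerivAt_id x).const_mul k).sin).ofReal_comp
      simpa [mul_comm] using this

/-- The cosine transform of the derivative of a function with vanishing trace at `0`. -/
theorem IsPrimitiveOf.cosineTransform_ae_eq {F : ℝ → ℂ} {f g : L2} (h : IsPrimitiveOf F f g)
    (h0 : F 0 = 0) :
    cosineTransform g =ᵐ[volume.restrict (Ioi (0 : ℝ))]
      fun k => (Complex.I * k) * sineTransform f k := by
  refine ae_eq_of_truncate
    (b := fun n k => (2 / √(2 * Real.pi) : ℂ) * (F n * (Real.cos (k * n) : ℂ)))
    (fun k => ?_) fun n => ?_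
  · have h1 : Tendsto (fun n : ℕ => F n) atTop (𝓝 0) :=
      h.tendsto_zero.comp tendsto_natCast_atTop_atTop
    have h2 : Tendsto (fun n : ℕ => F n * (Real.cos (k * n) : ℂ)) atTop (𝓝 0) := by
      refine squeeze_zero_norm (fun n => ?_) (tendsto_zero_iff_norm_tendsto_zero.1 h1)
      rw [norm_mul, Complex.norm_real]
      exact mul_le_of_le_one_right (norm_nonneg _) (Real.abs_cos_le_one _)
    simpa using h2.const_mul (2 / √(2 * Real.pi) : ℂ)
  · filter_upwards [HalfLine.sineTransform_ae_eq _ (integrable_truncate f n),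
      HalfLine.cosineTransform_ae_eq _ (integrable_truncate g n)] with k h1 h2
    rw [h1, h2, h.integral_mul_truncate (w := fun x => (Real.cos (k * x) : ℂ))
      (w' := fun x => -(k : ℂ) * (Real.sin (k * x) : ℂ)) (fun x => ?_) (by fun_prop)]
    · simp only [h0, zero_mul, sub_zero, mul_assoc, integral_const_mul]
      linear_combination ((k : ℂ) * (2 / √(2 * Real.pi) : ℂ) *
        ∫ x in Ioi (0 : ℝ), (Real.sin (k * x) : ℂ) * truncate f n x) * Complex.I_sq
    · have := (((hasDerivAt_id x).const_mul k).cos).ofReal_comp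
      simpa [mul_comm] using this

/-! ### The Hamiltonians in Fourier space -/

/-- The Fourier-sine transform diagonalizes the Dirichlet Hamiltonian. -/
theorem sineTransform_of_mem_dirichletGraph {hbar m : ℝ} {ψ χ : L2}
    (h : (ψ, χ) ∈ dirichletGraph hbar m) : sineTransform χ =ᵐ[volume.restrict (Ioi (0 : ℝ))]
      fun k => ((hbar ^ 2 / (2 * m) * k ^ 2 : ℝ) : ℂ) * sineTransform ψ k := by
  obtain ⟨h0, ψ₁, ψ₂, h1, h2, h3⟩ := h
  obtain ⟨F, hF⟩ := h1.exists_isPrimitiveOf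
  obtain ⟨F₁, hF₁⟩ := h2.exists_isPrimitiveOf
  simp only at h3 h0
  rw [h3, map_smul]
  filter_upwards [hF₁.sineTransform_ae_eq, hF.cosineTransform_ae_eq (hF.apply_zero_of_memH10 h0),
    Lp.coeFn_smul (-(hbar ^ 2 / (2 * m) : ℝ) : ℂ) (sineTransform ψ₂)] with k k1 k2 k3
  rw [k3, Pi.smul_apply, k1, k2, smul_eq_mul]
  push_cast
  linear_combination (-(hbar ^ 2 / (2 * m) : ℂ) * k ^ 2 * sineTransform ψ k) * Complex.I_sq

/-- The Fourier-cosine transform diagonalizes the Neumann Hamiltonian. -/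
theorem cosineTransform_of_mem_neumannGraph {hbar m : ℝ} {ψ χ : L2}
    (h : (ψ, χ) ∈ neumannGraph hbar m) : cosineTransform χ =ᵐ[volume.restrict (Ioi (0 : ℝ))]
      fun k => ((hbar ^ 2 / (2 * m) * k ^ 2 : ℝ) : ℂ) * cosineTransform ψ k := by
  obtain ⟨ψ₁, ψ₂, h1, h2, h0, h3⟩ := h
  obtain ⟨F, hF⟩ := h1.exists_isPrimitiveOf
  obtain ⟨F₁, hF₁⟩ := h2.exists_isPrimitiveOf
  simp only at h3
  rw [h3, map_smul]
  filter_upwards [hF.sineTransform_ae_eq, hF₁.cosineTransform_ae_eq (hF₁.apply_zero_eq h0),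
    Lp.coeFn_smul (-(hbar ^ 2 / (2 * m) : ℝ) : ℂ) (cosineTransform ψ₂)] with k k1 k2 k3
  rw [k3, Pi.smul_apply, k2, k1, smul_eq_mul]
  push_cast
  linear_combination (-(hbar ^ 2 / (2 * m) : ℂ) * k ^ 2 * cosineTransform ψ k) * Complex.I_sq

/-! ### Surjectivity of `-d²/dx² + 1` -/

/-- The weak form of `-ψ'' + ψ = h` is solvable in every closed subspace `K` of `L² × L²`, by
orthogonal projection of `(h, 0)` to `K`. -/
theorem exists_weak_solution (K : Submodule ℂ (L2 × L2)) (hK : IsClosed (K : Set (L2 × L2)))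
    (h : L2) : ∃ p ∈ K, ∀ q ∈ K, inner ℂ q.1 (h - p.1) = inner ℂ q.2 p.2 := by
  let e := WithLp.prodContinuousLinearEquiv 2 ℂ L2 L2
  let K' : Submodule ℂ (WithLp 2 (L2 × L2)) := K.comap e.toLinearMap
  have hK' : IsClosed (K' : Set (WithLp 2 (L2 × L2))) := hK.preimage e.continuous
  have : CompleteSpace K' := hK'.completeSpace_coe
  let P := K'.starProjection (WithLp.toLp 2 (h, 0))
  have hP : P ∈ K' := Submodule.starProjection_apply_mem _ _
  refine ⟨(P.fst, P.snd), hP, fun q hq => ?_⟩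
  have h1 := Submodule.inner_right_of_mem_orthogonal (K := K') (u := WithLp.toLp 2 q) hq
    (Submodule.sub_starProjection_mem_orthogonal (WithLp.toLp 2 (h, (0 : L2))))
  rw [WithLp.prod_inner_apply] at h1
  simp only [WithLp.ofLp_sub] at h1
  have h2 : inner ℂ q.1 (h - P.fst) + inner ℂ q.2 (0 - P.snd) = 0 := h1
  rw [zero_sub, inner_neg_right] at h2
  exact (eq_neg_of_add_eq_zero_left h2).trans (neg_neg _)

theorem isWeakDeriv_of_weak_solution {h ψ ψ₁ : L2}
    (H : ∀ φ (hφ : IsTestFunction φ),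
      inner ℂ hφ.memLp.toLp (h - ψ) = inner ℂ hφ.deriv.memLp.toLp ψ₁) :
    IsWeakDeriv ψ₁ (ψ - h) := by
  refine isWeakDeriv_iff_pairing.2 fun φ hφ => ?_
  have h1 := H _ hφ.conj
  have hd : deriv (fun x => starRingEnd ℂ (φ x)) = fun x => starRingEnd ℂ (deriv φ x) := by
    ext x
    exact (hφ.smooth.differentiable (by simp) x).hasDerivAt.star.deriv
  rw [hφ.inner_conj_toLp, inner_toLp] at h1
  simp only [hd, Complex.conj_conj] at h1
  rw [← pairing_toLp hφ.memLp, ← pairing_toLp hφ.deriv.memLp] at h1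
  rw [← h1, ← map_add]
  simp

/-- The graph of the weak derivative on `H¹₀(ℝ₊)`. -/
def weakDerivH10 : Submodule ℂ (L2 × L2) where
  carrier := closure testPairs
  zero_mem' := subset_closure ⟨0, IsTestFunction.zero, Lp.coeFn_zero ℂ 2 _, by
    have : deriv (0 : ℝ → ℂ) = 0 := by ext; simp
    rw [this]; exact Lp.coeFn_zero ℂ 2 _⟩
  add_mem' := by
    intro p q hp hq
    refine map_mem_closure₂ (f := fun p q : L2 × L2 => p + q) continuous_add hp hq ?_
    rintro p ⟨φ, h, h1, h2⟩ q ⟨χ, k, k1, k2⟩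
    refine ⟨φ + χ, h.add k, (Lp.coeFn_add _ _).trans (h1.add k1), ?_⟩
    have : deriv (φ + χ) = deriv φ + deriv χ := by
      ext x
      exact deriv_add (h.smooth.differentiable (by simp) x) (k.smooth.differentiable (by simp) x)
    rw [this]
    exact (Lp.coeFn_add _ _).trans (h2.add k2)
  smul_mem' := by
    intro c p hp
    refine map_mem_closure (f := fun p : L2 × L2 => c • p) (continuous_const_smul c) hp ?_
    rintro p ⟨φ, h, h1, h2⟩
    refine ⟨c • φ, h.const_smul c, (Lp.coeFn_smul _ _).trans (h1.const_smul c), ?_⟩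
    have : deriv (c • φ) = c • deriv φ := by
      ext x
      exact deriv_const_smul c (h.smooth.differentiable (by simp) x)
    rw [this]
    exact (Lp.coeFn_smul _ _).trans (h2.const_smul c)

/-- The graph of the weak derivative on `H¹(ℝ₊)`. -/
def weakDerivH1 : Submodule ℂ (L2 × L2) where
  carrier := {p | IsWeakDeriv p.1 p.2}
  zero_mem' := isWeakDeriv_zero
  add_mem' := fun h k => h.add k
  smul_mem' := fun c _ h => h.smul c

theorem exists_dirichlet_solution {hbar m : ℝ} (hh : 0 < hbar) (hm : 0 < m) (h : L2) :
    ∃ ψ χ, (ψ, χ) ∈ dirichletGraph hbar m ∧ χ + ((hbar ^ 2 / (2 * m) : ℝ) : ℂ) • ψ = h := by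
  have hc : ((hbar ^ 2 / (2 * m) : ℝ) : ℂ) ≠ 0 := by
    exact_mod_cast (by positivity : hbar ^ 2 / (2 * m) ≠ 0)
  obtain ⟨⟨ψ, ψ₁⟩, hp, H⟩ := exists_weak_solution weakDerivH10 isClosed_closure
    (((hbar ^ 2 / (2 * m) : ℝ) : ℂ)⁻¹ • h)
  refine ⟨ψ, _, ⟨⟨ψ₁, hp⟩, ψ₁, _, isWeakDeriv_of_mem_closure_testPairs hp,
    isWeakDeriv_of_weak_solution fun φ hφ =>
      H (hφ.memLp.toLp, hφ.deriv.memLp.toLp) (subset_closure (mem_testPairs.2 ⟨φ, hφ, rfl⟩)),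
    rfl⟩, ?_⟩
  rw [smul_sub, neg_smul, neg_smul, smul_inv_smul₀ hc]
  abel

theorem exists_neumann_solution {hbar m : ℝ} (hh : 0 < hbar) (hm : 0 < m) (h : L2) :
    ∃ ψ χ, (ψ, χ) ∈ neumannGraph hbar m ∧ χ + ((hbar ^ 2 / (2 * m) : ℝ) : ℂ) • ψ = h := by
  have hc : ((hbar ^ 2 / (2 * m) : ℝ) : ℂ) ≠ 0 := by
    exact_mod_cast (by positivity : hbar ^ 2 / (2 * m) ≠ 0)
  obtain ⟨⟨ψ, ψ₁⟩, hp, H⟩ := exists_weak_solution weakDerivH1 isClosed_setOf_isWeakDeriv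
    (((hbar ^ 2 / (2 * m) : ℝ) : ℂ)⁻¹ • h)
  have hp : IsWeakDeriv ψ ψ₁ := hp
  have hw := isWeakDeriv_of_weak_solution fun φ hφ =>
      H (hφ.memLp.toLp, hφ.deriv.memLp.toLp) hφ.isPrimitiveOf.isWeakDeriv
  obtain ⟨F, hF⟩ := hw.exists_isPrimitiveOf
  -- the natural boundary condition: test the weak equation against `exp (-x)`
  have h0 : F 0 = 0 := by
    have h1 := H (memLp_exp_neg.toLp, memLp_exp_neg.neg.toLp) isPrimitiveOf_exp_neg.isWeakDeriv
    have h2 := hF.pairing_add_pairing isPrimitiveOf_exp_neg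
    rw [inner_toLp, inner_toLp] at h1
    simp only [Pi.neg_apply, map_neg, Complex.conj_ofReal] at h1
    rw [pairing_comm, pairing_comm ψ₁, pairing_toLp, pairing_toLp] at h2
    have h3 : ∀ f : L2, ∫ x in Ioi (0 : ℝ), (Real.exp (-x) : ℂ) * f x
        = pairing memLp_exp_neg.toLp f := fun f => (pairing_toLp memLp_exp_neg f).symm
    simp only [Pi.neg_apply, neg_mul, integral_neg, h3] at h1 h2
    rw [← h1, ← map_add] at h2
    simpa using h2
  refine ⟨ψ, _, ⟨ψ₁, _, hp, hw, h0 ▸ hF.hasBoundaryValue, rfl⟩, ?_⟩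
  rw [smul_sub, neg_smul, neg_smul, smul_inv_smul₀ hc]
  abel

theorem IsTestFunction.mem_dirichletGraph {φ : ℝ → ℂ} (h : IsTestFunction φ) (hbar m : ℝ) :
    ∃ χ, (h.memLp.toLp, χ) ∈ dirichletGraph hbar m :=
  ⟨_, ⟨_, subset_closure (mem_testPairs.2 ⟨φ, h, rfl⟩)⟩, _, _, h.isPrimitiveOf.isWeakDeriv,
    h.deriv.isPrimitiveOf.isWeakDeriv, rfl⟩

theorem IsTestFunction.mem_neumannGraph {φ : ℝ → ℂ} (h : IsTestFunction φ) (hbar m : ℝ) :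
    ∃ χ, (h.memLp.toLp, χ) ∈ neumannGraph hbar m := by
  refine ⟨_, _, _, h.isPrimitiveOf.isWeakDeriv, h.deriv.isPrimitiveOf.isWeakDeriv, ?_, rfl⟩
  have := h.deriv.isPrimitiveOf.hasBoundaryValue
  rwa [h.deriv.eq_zero le_rfl] at this

/-! ### The free evolution in Fourier space -/

theorem mul_apply_L2 (S T : L2 →L[ℂ] L2) (f : L2) : (S * T) f = S (T f) := rfl

/-- The phase `exp (-i t α k²)`. -/
def phase (α t k : ℝ) : ℂ := Complex.exp ((-(t * α * k ^ 2) : ℝ) * Complex.I)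

theorem norm_phase (α t k : ℝ) : ‖phase α t k‖ = 1 := Complex.norm_exp_ofReal_mul_I _

theorem continuous_phase (α t : ℝ) : Continuous (phase α t) := by unfold phase; fun_prop

theorem phase_zero (α k : ℝ) : phase α 0 k = 1 := by simp [phase]

theorem phase_add (α s t k : ℝ) : phase α (s + t) k = phase α s k * phase α t k := by
  rw [phase, phase, phase, ← Complex.exp_add]
  congr 1
  push_cast
  ring

theorem hasDerivAt_phase (α t k : ℝ) :
    HasDerivAt (fun t => phase α t k) (-(Complex.I * (α * k ^ 2 : ℝ)) * phase α t k) t := by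
  have h1 : HasDerivAt (fun t : ℝ => -(t * α * k ^ 2)) (-(1 * α * k ^ 2)) t :=
    (((hasDerivAt_id t).mul_const α).mul_const (k ^ 2)).neg
  have h2 := (h1.ofReal_comp.mul_const Complex.I).cexp
  unfold phase
  convert! h2 using 1
  push_cast
  ring

theorem norm_phase_sub_one_le (α t k : ℝ) : ‖phase α t k - 1‖ ≤ |t| * |α * k ^ 2| := by
  have := Real.norm_exp_I_mul_ofReal_sub_one_le (x := -(t * α * k ^ 2))
  rw [phase, mul_comm _ Complex.I]
  refine this.trans (le_of_eq ?_)
  rw [norm_neg, Real.norm_eq_abs, mul_assoc, abs_mul]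

theorem memLp_phase_mul (α t : ℝ) (f : L2) :
    MemLp (fun k => phase α t k * f k) 2 (volume.restrict (Ioi (0 : ℝ))) := by
  refine (Lp.memLp f).of_le ((continuous_phase α t).aestronglyMeasurable.mul
    (Lp.aestronglyMeasurable f)) (Eventually.of_forall fun k => ?_)
  rw [norm_mul, norm_phase, one_mul]

theorem norm_toLp_phase_mul (α t : ℝ) (f : L2) : ‖(memLp_phase_mul α t f).toLp‖ = ‖f‖ := by
  rw [Lp.norm_toLp, Lp.norm_def]
  congr 1
  refine eLpNorm_congr_norm_ae (Eventually.of_forall fun k => ?_)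
  rw [norm_mul, norm_phase, one_mul]

/-- Multiplication by `exp (-i t α k²)` on `L²(ℝ₊)`. -/
def phaseMul (α t : ℝ) : L2 →L[ℂ] L2 :=
  LinearMap.mkContinuous
    { toFun := fun f => (memLp_phase_mul α t f).toLp
      map_add' := fun f g => by
        rw [← MemLp.toLp_add]
        refine MemLp.toLp_congr _ _ ?_
        filter_upwards [Lp.coeFn_add f g] with k hk
        rw [hk, Pi.add_apply, Pi.add_apply, mul_add]
      map_smul' := fun c f => by
        rw [RingHom.id_apply, ← MemLp.toLp_const_smul]
        refine MemLp.toLp_congr _ _ ?_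
        filter_upwards [Lp.coeFn_smul c f] with k hk
        rw [hk, Pi.smul_apply, Pi.smul_apply, smul_eq_mul, smul_eq_mul, mul_left_comm] }
    1 (fun f => by rw [one_mul]; exact (norm_toLp_phase_mul α t f).le)

theorem phaseMul_ae_eq (α t : ℝ) (f : L2) :
    phaseMul α t f =ᵐ[volume.restrict (Ioi (0 : ℝ))] fun k => phase α t k * f k :=
  (memLp_phase_mul α t f).coeFn_toLp

theorem phaseMul_zero (α : ℝ) : phaseMul α 0 = 1 := by
  ext1 f
  refine Lp.ext ?_
  filter_upwards [phaseMul_ae_eq α 0 f] with k hk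
  rw [hk, phase_zero, one_mul]
  rfl

theorem phaseMul_add (α s t : ℝ) : phaseMul α (s + t) = phaseMul α s * phaseMul α t := by
  ext1 f
  refine Lp.ext ?_
  rw [mul_apply_L2]
  filter_upwards [phaseMul_ae_eq α (s + t) f, phaseMul_ae_eq α s (phaseMul α t f),
    phaseMul_ae_eq α t f] with k h1 h2 h3
  rw [h1, h2, h3, phase_add, mul_assoc]

theorem phaseMul_mem_unitary (α t : ℝ) : phaseMul α t ∈ unitary (L2 →L[ℂ] L2) := by
  have h1 : star (phaseMul α t) * phaseMul α t = 1 :=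
    (ContinuousLinearMap.norm_map_iff_adjoint_comp_self _).1 (norm_toLp_phase_mul α t)
  have h2 : phaseMul α t * phaseMul α (-t) = 1 := by
    rw [← phaseMul_add, add_neg_cancel, phaseMul_zero]
  refine Unitary.mem_iff.2 ⟨h1, ?_⟩
  rwa [left_inv_eq_right_inv h1 h2]

theorem continuous_phaseMul (α : ℝ) (f : L2) : Continuous fun t => phaseMul α t f := by
  refine continuous_iff_continuousAt.2 fun t => ?_
  refine tendsto_L2_of_dominated (G := fun k => 4 * ‖f k‖ ^ 2)
    (((Lp.memLp f).integrable_norm_pow (by norm_num)).const_mul 4)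
    (fun s => phaseMul_ae_eq α s f) (Eventually.of_forall fun s => ?_) ?_
  · filter_upwards [phaseMul_ae_eq α t f] with k hk
    rw [hk, ← sub_mul, norm_mul, mul_pow]
    have : ‖phase α s k - phase α t k‖ ≤ 2 := by
      refine (norm_sub_le _ _).trans ?_
      rw [norm_phase, norm_phase]; norm_num
    gcongr
    nlinarith [norm_nonneg (phase α s k - phase α t k)]
  · filter_upwards [phaseMul_ae_eq α t f] with k hk
    rw [hk]
    exact (hasDerivAt_phase α t k).continuousAt.tendsto.mul_const _

theorem tendsto_phase_quotient (α k : ℝ) :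
    Tendsto (fun t : ℝ => (t : ℂ)⁻¹ * (phase α t k - 1)) (𝓝[≠] 0)
      (𝓝 (-(Complex.I * (α * k ^ 2 : ℝ)))) := by
  have := hasDerivAt_iff_tendsto_slope_zero.1 (hasDerivAt_phase α 0 k)
  simp only [zero_add, phase_zero, mul_one] at this
  refine this.congr fun t => ?_
  rw [Complex.real_smul, Complex.ofReal_inv]

theorem phaseMul_quotient_ae_eq (α t : ℝ) (f : L2) :
    (t : ℂ)⁻¹ • (phaseMul α t f - f) =ᵐ[volume.restrict (Ioi (0 : ℝ))]
      fun k => (t : ℂ)⁻¹ * (phase α t k - 1) * f k := by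
  filter_upwards [phaseMul_ae_eq α t f, Lp.coeFn_sub (phaseMul α t f) f,
    Lp.coeFn_smul (t : ℂ)⁻¹ (phaseMul α t f - f)] with k h1 h2 h3
  rw [h3, Pi.smul_apply, h2, Pi.sub_apply, h1, smul_eq_mul]
  ring

/-- The generator of the multiplication group: its domain consists of the `f ∈ L²` with
`k² f ∈ L²`. -/
theorem tendsto_phaseMul_quotient_iff (α : ℝ) (f g : L2) :
    Tendsto (fun t : ℝ => (t : ℂ)⁻¹ • (phaseMul α t f - f)) (𝓝[≠] 0) (𝓝 g) ↔
      g =ᵐ[volume.restrict (Ioi (0 : ℝ))] fun k => -(Complex.I * (α * k ^ 2 : ℝ)) * f k := by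
  constructor
  · intro h
    obtain ⟨ns, hns, hae⟩ := (tendstoInMeasure_of_tendsto_Lp h).exists_seq_tendsto_ae'
    filter_upwards [hae, ae_all_iff.2 fun i => phaseMul_quotient_ae_eq α (ns i) f] with k h1 h2
    refine tendsto_nhds_unique h1 ?_
    refine Tendsto.congr (fun i => (h2 i).symm) ?_
    exact ((tendsto_phase_quotient α k).comp hns).mul_const (f k)
  · intro h
    refine tendsto_L2_of_dominated (G := fun k => 4 * ‖g k‖ ^ 2)
      (((Lp.memLp g).integrable_norm_pow (by norm_num)).const_mul 4)
      (fun t => phaseMul_quotient_ae_eq α t f) ?_ ?_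
    · filter_upwards [self_mem_nhdsWithin] with t ht
      have ht : t ≠ 0 := ht
      filter_upwards [h] with k hk
      have h1 : ‖(t : ℂ)⁻¹ * (phase α t k - 1) * f k‖ ≤ ‖g k‖ := by
        rw [hk, norm_mul, norm_mul, norm_mul, norm_neg, norm_mul, Complex.norm_I, one_mul,
          norm_inv, Complex.norm_real, Complex.norm_real, Real.norm_eq_abs, Real.norm_eq_abs]
        gcongr
        rw [inv_mul_le_iff₀ (abs_pos.2 ht)]
        exact norm_phase_sub_one_le α t k
      have h2 := (norm_sub_le _ _).trans (add_le_add_left h1 ‖g k‖)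
      calc _ ≤ (‖g k‖ + ‖g k‖) ^ 2 := by gcongr
        _ = _ := by ring
    · filter_upwards [h] with k hk
      rw [hk]
      exact (tendsto_phase_quotient α k).mul_const (f k)

/-! ### Unitary groups generated by diagonalized operators -/

theorem star_apply_apply {F : L2 →L[ℂ] L2} (hF : F ∈ unitary (L2 →L[ℂ] L2)) (ψ : L2) :
    star F (F ψ) = ψ := by
  rw [← mul_apply_L2, (Unitary.mem_iff.1 hF).1]
  rfl

theorem apply_star_apply {F : L2 →L[ℂ] L2} (hF : F ∈ unitary (L2 →L[ℂ] L2)) (ψ : L2) :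
    F (star F ψ) = ψ := by
  rw [← mul_apply_L2, (Unitary.mem_iff.1 hF).2]
  rfl

/-- An operator `A` that is contained in `F* (ħ α k²) F`, with `F` unitary, and for which
`A + ħ α` is surjective generates the unitary group `F* exp (-i t α k²) F`. -/
theorem isUnitaryGroupOf_of_diagonal {hbar α : ℝ} (hh : 0 < hbar) (hα : 0 < α)
    {A : L2 →ₗ.[ℂ] L2} {F : L2 →L[ℂ] L2} (hF : F ∈ unitary (L2 →L[ℂ] L2))
    (hdiag : ∀ ψ χ, (ψ, χ) ∈ A.graph → F χ =ᵐ[volume.restrict (Ioi (0 : ℝ))]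
      fun k => ((hbar * α * k ^ 2 : ℝ) : ℂ) * F ψ k)
    (hsurj : ∀ h, ∃ ψ χ, (ψ, χ) ∈ A.graph ∧ χ + ((hbar * α : ℝ) : ℂ) • ψ = h) :
    IsUnitaryGroupOf hbar A fun t => star F * phaseMul α t * F where
  unitary t := mul_mem (mul_mem (Unitary.star_mem hF) (phaseMul_mem_unitary α t)) hF
  map_zero := by rw [phaseMul_zero, mul_one, (Unitary.mem_iff.1 hF).1]
  map_add s t := by
    rw [phaseMul_add, show star F * phaseMul α s * F * (star F * phaseMul α t * F)
      = star F * phaseMul α s * (F * star F) * phaseMul α t * F by simp only [mul_assoc],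
      (Unitary.mem_iff.1 hF).2, mul_one]
    simp only [mul_assoc]
  continuous ψ := (star F).continuous.comp (continuous_phaseMul α (F ψ))
  generator ψ χ := by
    have hhc : (hbar : ℂ) ≠ 0 := by exact_mod_cast hh.ne'
    -- the difference quotient, transported to Fourier space
    have key : ∀ ψ χ : L2, Tendsto (fun t : ℝ => (t : ℂ)⁻¹ •
        ((star F * phaseMul α t * F) ψ - ψ)) (𝓝[≠] 0) (𝓝 (-(Complex.I / hbar) • χ)) ↔
        F χ =ᵐ[volume.restrict (Ioi (0 : ℝ))]
          fun k => ((hbar * α * k ^ 2 : ℝ) : ℂ) * F ψ k := by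
      intro ψ χ
      have e1 : Tendsto (fun t : ℝ => (t : ℂ)⁻¹ • ((star F * phaseMul α t * F) ψ - ψ)) (𝓝[≠] 0)
          (𝓝 (-(Complex.I / hbar) • χ)) ↔
          Tendsto (fun t : ℝ => (t : ℂ)⁻¹ • (phaseMul α t (F ψ) - F ψ)) (𝓝[≠] 0)
            (𝓝 (-(Complex.I / hbar) • F χ)) := by
        constructor
        · intro h
          have := (F.continuous.tendsto _).comp h
          rw [map_smul] at this
          refine this.congr fun t => ?_
          simp only [Function.comp_apply, map_smul, map_sub,
            mul_apply_L2, apply_star_apply hF]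
        · intro h
          have := ((star F).continuous.tendsto _).comp h
          rw [map_smul, star_apply_apply hF] at this
          refine this.congr fun t => ?_
          simp only [Function.comp_apply, map_smul, map_sub,
            mul_apply_L2, star_apply_apply hF]
      rw [e1, tendsto_phaseMul_quotient_iff]
      have e2 := Lp.coeFn_smul (-(Complex.I / hbar)) (F χ)
      have hI : -(Complex.I / hbar) ≠ 0 := neg_ne_zero.2 (div_ne_zero Complex.I_ne_zero hhc)
      constructor <;> intro h <;> filter_upwards [h, e2] with k h1 h2
      · rw [h1, Pi.smul_apply, smul_eq_mul] at h2
        refine mul_left_cancel₀ hI (h2.symm.trans ?_)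
        push_cast
        field_simp
      · rw [h2, Pi.smul_apply, smul_eq_mul, h1]
        push_cast
        field_simp
    refine ⟨fun h => (key ψ χ).2 (hdiag ψ χ h), fun h => ?_⟩
    have h := (key ψ χ).1 h
    obtain ⟨φ, η, hmem, heq⟩ := hsurj (χ + ((hbar * α : ℝ) : ℂ) • ψ)
    -- `ψ - φ` is an eigenvector of the nonnegative multiplication operator
    -- with the negative eigenvalue `-ħ α`
    have hz : F (ψ - φ) = 0 := by
      have e3 : χ - η = -((hbar * α : ℝ) : ℂ) • (ψ - φ) := by
        rw [neg_smul, smul_sub, neg_sub, sub_eq_sub_iff_add_eq_add, ← heq, add_comm]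
      rw [Lp.eq_zero_iff_ae_eq_zero]
      have e4 : F χ - F η = -((hbar * α : ℝ) : ℂ) • F (ψ - φ) := by
        rw [← map_sub, e3, map_smul]
      have e5 : F (ψ - φ) = F ψ - F φ := map_sub _ _ _
      filter_upwards [h, hdiag φ η hmem, Lp.coeFn_sub (F χ) (F η), Lp.coeFn_sub (F ψ) (F φ),
        Lp.coeFn_smul (-((hbar * α : ℝ) : ℂ)) (F (ψ - φ))] with k h1 h2 h3 h4 h5
      rw [← e5] at h4
      rw [← e4, h3, Pi.sub_apply, Pi.smul_apply, h1, h2, ← mul_sub, smul_eq_mul] at h5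
      rw [Pi.sub_apply] at h4
      rw [← h4] at h5
      have h6 : ((hbar * α * k ^ 2 + hbar * α : ℝ) : ℂ) * F (ψ - φ) k = 0 := by
        push_cast at h5 ⊢
        linear_combination h5
      rcases mul_eq_zero.1 h6 with h7 | h7
      · have : hbar * α * k ^ 2 + hbar * α = 0 := by exact_mod_cast h7
        have : 0 < hbar * α * k ^ 2 + hbar * α := by positivity
        linarith
      · exact h7
    have hψ : ψ = φ := by
      have := star_apply_apply hF (ψ - φ)
      rw [hz, map_zero] at this
      exact sub_eq_zero.1 this.symm
    subst hψ
    rwa [add_right_cancel heq] at hmem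

/-! ### Uniqueness in Stone's theorem -/

namespace IsUnitaryGroupOf

variable {hbar : ℝ} {A : L2 →ₗ.[ℂ] L2} {U V : ℝ → (L2 →L[ℂ] L2)}

theorem norm_apply (h : IsUnitaryGroupOf hbar A U) (t : ℝ) (ψ : L2) : ‖U t ψ‖ = ‖ψ‖ :=
  (ContinuousLinearMap.norm_map_iff_adjoint_comp_self (U t)).2
    (Unitary.mem_iff.1 (h.unitary t)).1 ψ

theorem apply_mem_graph (h : IsUnitaryGroupOf hbar A U) {ψ χ : L2} (hψ : (ψ, χ) ∈ A.graph)
    (t : ℝ) : (U t ψ, U t χ) ∈ A.graph := by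
  refine (h.generator _ _).2 ?_
  have := ((U t).continuous.tendsto _).comp ((h.generator _ _).1 hψ)
  rw [map_smul] at this
  refine this.congr fun s => ?_
  simp only [Function.comp_apply, map_smul, map_sub, ← mul_apply_L2,
    ← h.map_add, add_comm]

theorem hasDerivAt_zero (h : IsUnitaryGroupOf hbar A U) {ψ χ : L2} (hψ : (ψ, χ) ∈ A.graph) :
    HasDerivAt (fun t => U t ψ) (-(Complex.I / hbar) • χ) 0 := by
  rw [hasDerivAt_iff_tendsto_slope_zero]
  refine ((h.generator _ _).1 hψ).congr fun t => ?_
  rw [zero_add, h.map_zero, ← Complex.ofReal_inv, Complex.coe_smul]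
  rfl

theorem hasDerivAt (h : IsUnitaryGroupOf hbar A U) {ψ χ : L2} (hψ : (ψ, χ) ∈ A.graph) (t : ℝ) :
    HasDerivAt (fun t => U t ψ) (-(Complex.I / hbar) • U t χ) t := by
  have h1 : HasDerivAt (fun s => U s (U t ψ)) (-(Complex.I / hbar) • U t χ) (t - t) := by
    rw [sub_self]
    exact h.hasDerivAt_zero (h.apply_mem_graph hψ t)
  refine (h1.comp_sub_const t t).congr_of_eventuallyEq (Eventually.of_forall fun s => ?_)
  simp only [← mul_apply_L2, ← h.map_add,
    sub_add_cancel]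

/-- Since `‖U_t ψ‖` is constant, the generator does not change the norm to first order; this is the
real part of skew-symmetry. -/
theorem inner_eq_zero (h : IsUnitaryGroupOf hbar A U) {ψ χ : L2} (hψ : (ψ, χ) ∈ A.graph) :
    inner ℝ ψ (-(Complex.I / hbar) • χ) = 0 := by
  have h1 := (h.hasDerivAt_zero hψ).norm_sq
  simp only [h.norm_apply] at h1
  have h2 := h1.unique (hasDerivAt_const 0 (‖ψ‖ ^ 2))
  rw [h.map_zero] at h2
  simpa using h2

theorem unique (h : IsUnitaryGroupOf hbar A U) (k : IsUnitaryGroupOf hbar A V)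
    (hA : ∀ f ∈ testFunctions, ∃ χ, (f, χ) ∈ A.graph) : U = V := by
  funext t
  refine clm_ext_of_testFunctions fun ψ hψ => ?_
  obtain ⟨χ, hχ⟩ := hA ψ hψ
  have hd : ∀ t, HasDerivAt (fun t => ‖U t ψ - V t ψ‖ ^ 2) 0 t := by
    intro t
    have h1 := ((h.hasDerivAt hχ t).sub (k.hasDerivAt hχ t)).norm_sq
    have h2 := h.inner_eq_zero (A.graph.sub_mem (h.apply_mem_graph hχ t) (k.apply_mem_graph hχ t))
    rw [← smul_sub] at h1
    rw [Pi.sub_apply, h2, mul_zero] at h1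
    exact h1
  have h3 := is_const_of_deriv_eq_zero (fun t => (hd t).differentiableAt)
    (fun t => (hd t).deriv) t 0
  rw [h.map_zero, k.map_zero, sub_self, norm_zero] at h3
  simpa [sub_eq_zero] using h3

end IsUnitaryGroupOf

/-! ### Non-stationary phase -/

/-- Integration by parts in an oscillatory integral over `k > 0` whose phase `x k + s k²` has no
stationary point there. -/
theorem IsTestFunction.norm_oscillatory_integral_le {φ : ℝ → ℂ} (hφ : IsTestFunction φ) :
    ∃ D a : ℝ, 0 < a ∧ ∀ σ : ℝ, |σ| = 1 → ∀ s > 0, ∀ x > 0,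
      ‖∫ k in Ioi (0 : ℝ), φ k * Complex.exp ((-(σ * (x * k + s * k ^ 2)) : ℝ) * Complex.I)‖
        ≤ D / (x + a * s) := by
  obtain ⟨a, b, ha, hab, hsub⟩ := hφ.exists_tsupport_subset_Ico
  obtain ⟨M, hM⟩ := hφ.smooth.continuous.bounded_above_of_compact_support hφ.compactSupport
  obtain ⟨M', hM'⟩ := hφ.deriv.smooth.continuous.bounded_above_of_compact_support
    hφ.deriv.compactSupport
  set d := a / 2 with hd
  have hd0 : 0 < d := half_pos ha
  have hdb : d ≤ b := by linarith
  have hMnn : 0 ≤ M := (norm_nonneg _).trans (hM 0)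
  refine ⟨(M' + M / d) * (b - d), 2 * d, by positivity, fun σ hσ s hs x hx => ?_⟩
  have hσ0 : σ ≠ 0 := by
    rintro rfl
    simp at hσ
  have hφd : φ d = 0 := image_eq_zero_of_notMem_tsupport fun h => by
    linarith [(hsub h).1]
  have hφb : φ b = 0 := image_eq_zero_of_notMem_tsupport fun h => lt_irrefl _ (hsub h).2
  set e : ℝ → ℂ := fun k => Complex.exp ((-(σ * (x * k + s * k ^ 2)) : ℝ) * Complex.I) with he
  have hne : ∀ k, ‖e k‖ = 1 := fun k => Complex.norm_exp_ofReal_mul_I _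
  have hec : Continuous e := by rw [he]; fun_prop
  -- the derivative of the phase
  set p : ℝ → ℝ := fun k => x + 2 * s * k with hp
  have hppos : ∀ k ∈ uIcc d b, x + 2 * d * s ≤ p k := by
    intro k hk
    rw [uIcc_of_le hdb] at hk
    simp only [hp]
    nlinarith [hk.1]
  have hc0 : 0 < x + 2 * d * s := by positivity
  have hde : ∀ k, HasDerivAt e (-(σ * p k : ℝ) * Complex.I * e k) k := by
    intro k
    have h1 : HasDerivAt (fun k : ℝ => -(σ * (x * k + s * k ^ 2)))
        (-(σ * (x * 1 + s * (2 * k)))) k := by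
      have := ((((hasDerivAt_id k).const_mul x).add
        ((hasDerivAt_pow 2 k).const_mul s)).const_mul σ).neg
      convert! this using 1
      simp
    have h2 := (h1.ofReal_comp.mul_const Complex.I).cexp
    convert! h2 using 1
    simp only [he, hp]
    push_cast
    ring
  have hpd : ∀ k, HasDerivAt (fun k => (p k : ℂ)) (2 * s : ℝ) k := by
    intro k
    have h1 : HasDerivAt p (2 * s) k := by
      have := ((hasDerivAt_id k).const_mul (2 * s)).const_add x
      rw [mul_one] at this
      exact this
    exact h1.ofReal_comp
  have hp0 : ∀ k ∈ uIcc d b, (p k : ℂ) ≠ 0 := fun k hk => by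
    exact_mod_cast (hc0.trans_le (hppos k hk)).ne'
  set u' : ℝ → ℂ := fun k =>
    (_root_.deriv φ k * (p k : ℂ) - φ k * (2 * s : ℝ)) / (p k : ℂ) ^ 2 with hu'
  have hdu : ∀ k ∈ uIcc d b, HasDerivAt (fun k => φ k / (p k : ℂ)) (u' k) k := fun k hk =>
    ((hφ.smooth.differentiable (by simp) k).hasDerivAt).div (hpd k) (hp0 k hk)
  have hpc : Continuous fun k => (p k : ℂ) := by simp only [hp]; fun_prop
  have hu'c : ContinuousOn u' (uIcc d b) := by
    refine ContinuousOn.div ?_ (hpc.pow 2).continuousOn fun k hk => pow_ne_zero 2 (hp0 k hk)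
    exact (((hφ.deriv.smooth.continuous).mul hpc).sub
      (hφ.smooth.continuous.mul continuous_const)).continuousOn
  have hbound : ∀ k ∈ uIcc d b, ‖u' k‖ ≤ (M' + M / d) / (x + 2 * d * s) := by
    intro k hk
    have hpk := hppos k hk
    have hpk0 := hc0.trans_le hpk
    have e1 : u' k = _root_.deriv φ k / (p k : ℂ) - φ k * ((2 * s / p k : ℝ) : ℂ) / (p k : ℂ) := by
      simp only [hu']
      have := hp0 k hk
      push_cast
      field_simp
    -- `2 s` is the second derivative of the phase; it is of the order of `p k`, as `p k ≥ 2 s d`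
    have e2 : 2 * s / p k ≤ 1 / d := by
      rw [div_le_div_iff₀ hpk0 hd0]
      nlinarith
    have e3 : 0 ≤ 2 * s / p k := by positivity
    rw [e1]
    refine (norm_sub_le _ _).trans ?_
    rw [norm_div, norm_div, norm_mul, Complex.norm_real, Complex.norm_real,
      Real.norm_of_nonneg hpk0.le, Real.norm_of_nonneg e3, ← add_div]
    have e4 : ‖φ k‖ * (2 * s / p k) ≤ M / d := by
      calc _ ≤ M * (1 / d) := mul_le_mul (hM k) e2 e3 hMnn
        _ = M / d := by ring
    have e5 : 0 ≤ M' + M / d := by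
      have := (norm_nonneg _).trans (hM' 0)
      positivity
    exact div_le_div₀ e5 (add_le_add (hM' k) e4) hc0 hpk
  -- reduce to `[d, b]`, where the integration by parts has no boundary terms
  have hI : ∫ k in Ioi (0 : ℝ), φ k * e k = ∫ k in d..b, φ k * e k := by
    rw [intervalIntegral.integral_of_le hdb]
    refine setIntegral_eq_of_subset_of_forall_sdiff_eq_zero measurableSet_Ioi
      (fun k hk => hd0.trans hk.1) fun k hk => ?_
    rw [image_eq_zero_of_notMem_tsupport fun h => hk.2 ⟨?_, (hsub h).2.le⟩, zero_mul]
    linarith [(hsub h).1]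
  have hibp := intervalIntegral.integral_mul_deriv_eq_deriv_mul hdu (fun k _ => hde k)
    hu'c.intervalIntegrable (Continuous.intervalIntegrable (by fun_prop) _ _)
  have hI2 : ∫ k in d..b, φ k / (p k : ℂ) * (-(σ * p k : ℝ) * Complex.I * e k)
      = -(σ * Complex.I) * ∫ k in d..b, φ k * e k := by
    rw [← intervalIntegral.integral_const_mul]
    refine intervalIntegral.integral_congr fun k hk => ?_
    have := hp0 k hk
    push_cast
    field_simp
  rw [hI2, hφd, hφb, zero_div, zero_mul, zero_div, zero_mul, sub_zero, zero_sub] at hibp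
  have hn := congrArg norm hibp
  rw [norm_mul, norm_neg, norm_mul, Complex.norm_I, Complex.norm_real, Real.norm_eq_abs, hσ,
    mul_one, one_mul, norm_neg] at hn
  rw [hI, hn]
  refine (intervalIntegral.norm_integral_le_of_norm_le_const (C := (M' + M / d) / (x + 2 * d * s))
    fun k hk => ?_).trans (le_of_eq ?_)
  · rw [norm_mul, hne, mul_one]
    exact hbound k (uIoc_subset_uIcc hk)
  · rw [abs_of_nonneg (by linarith)]
    ring

/-- `F_c + σ F_s` has the kernel `exp (-i σ k x)`, up to a constant, for `σ = ±1`. -/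
theorem cosineTransform_add_smul_sineTransform_ae_eq {σ : ℝ} (hσ : |σ| = 1) (ψ : L2)
    (hψ : Integrable ψ (volume.restrict (Ioi (0 : ℝ)))) :
    cosineTransform ψ + (σ : ℂ) • sineTransform ψ =ᵐ[volume.restrict (Ioi (0 : ℝ))] fun x =>
      (2 / √(2 * Real.pi) : ℂ) *
        ∫ k in Ioi (0 : ℝ), Complex.exp ((-(σ * (x * k)) : ℝ) * Complex.I) * ψ k := by
  filter_upwards [sineTransform_ae_eq ψ hψ, cosineTransform_ae_eq ψ hψ,
    Lp.coeFn_add (cosineTransform ψ) ((σ : ℂ) • sineTransform ψ),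
    Lp.coeFn_smul (σ : ℂ) (sineTransform ψ)] with x h1 h2 h3 h4
  have i1 : Integrable (fun k => (Real.cos (x * k) : ℂ) * ψ k) (volume.restrict (Ioi (0 : ℝ))) := by
    refine hψ.bdd_mul (c := 1) (by fun_prop) (Eventually.of_forall fun k => ?_)
    rw [Complex.norm_real]
    exact Real.abs_cos_le_one _
  have i2 : Integrable (fun k => (Real.sin (x * k) : ℂ) * ψ k) (volume.restrict (Ioi (0 : ℝ))) := by
    refine hψ.bdd_mul (c := 1) (by fun_prop) (Eventually.of_forall fun k => ?_)
    rw [Complex.norm_real]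
    exact Real.abs_sin_le_one _
  have e1 : ∀ k : ℝ, Complex.exp ((-(σ * (x * k)) : ℝ) * Complex.I) * ψ k
      = (Real.cos (x * k) : ℂ) * ψ k - (σ * Complex.I) * ((Real.sin (x * k) : ℂ) * ψ k) := by
    intro k
    rw [Complex.exp_mul_I, ← Complex.ofReal_cos, ← Complex.ofReal_sin, Real.cos_neg, Real.sin_neg]
    rcases (abs_eq zero_le_one).1 hσ with rfl | rfl
    · simp only [one_mul]
      push_cast
      ring
    · simp only [neg_one_mul, Real.cos_neg, Real.sin_neg]
      push_cast
      ring
  simp only [e1]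
  rw [integral_sub i1 (i2.const_mul _), integral_const_mul, h3, Pi.add_apply, h4, Pi.smul_apply,
    h1, h2, smul_eq_mul]
  ring

/-- The free evolution of a test function in `k`, transformed with the kernel `exp (-i σ k x)`,
leaves the half-line `x > 0` as `σ t → ∞`. -/
theorem IsTestFunction.tendsto_zero {φ : ℝ → ℂ} (hφ : IsTestFunction φ) {α σ : ℝ} (hα : 0 < α)
    (hσ : |σ| = 1) {l : Filter ℝ} [l.IsCountablyGenerated] (hl : Tendsto (fun t => σ * t) l atTop) :
    Tendsto (fun t => cosineTransform (phaseMul α t hφ.memLp.toLp)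
      + (σ : ℂ) • sineTransform (phaseMul α t hφ.memLp.toLp)) l (𝓝 0) := by
  obtain ⟨D, a, ha, H⟩ := hφ.norm_oscillatory_integral_le
  have hσ2 : σ * σ = 1 := by rw [← abs_mul_abs_self, hσ, one_mul]
  have hae : ∀ t, phaseMul α t hφ.memLp.toLp =ᵐ[volume.restrict (Ioi (0 : ℝ))]
      fun k => phase α t k * φ k := by
    intro t
    filter_upwards [phaseMul_ae_eq α t hφ.memLp.toLp, hφ.memLp.coeFn_toLp] with k h1 h2
    rw [h1, h2]
  have hint : ∀ t, Integrable (phaseMul α t hφ.memLp.toLp) (volume.restrict (Ioi (0 : ℝ))) := by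
    intro t
    refine Integrable.congr ?_ (hae t).symm
    exact hφ.integrable.bdd_mul (c := 1) (continuous_phase α t).aestronglyMeasurable
      (Eventually.of_forall fun k => (norm_phase α t k).le)
  have hform : ∀ t, cosineTransform (phaseMul α t hφ.memLp.toLp)
      + (σ : ℂ) • sineTransform (phaseMul α t hφ.memLp.toLp) =ᵐ[volume.restrict (Ioi (0 : ℝ))]
      fun x => (2 / √(2 * Real.pi) : ℂ) * ∫ k in Ioi (0 : ℝ),
        φ k * Complex.exp ((-(σ * (x * k + (σ * t) * α * k ^ 2)) : ℝ) * Complex.I) := by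
    intro t
    refine (cosineTransform_add_smul_sineTransform_ae_eq hσ _ (hint t)).trans
      (Eventually.of_forall fun x => ?_)
    refine congrArg _ (integral_congr_ae ?_)
    filter_upwards [hae t] with k hk
    have : -(σ * (x * k + (σ * t) * α * k ^ 2)) = -(σ * (x * k)) + -(t * α * k ^ 2) := by
      linear_combination (-(t * α * k ^ 2)) * hσ2
    rw [hk, this, Complex.ofReal_add, add_mul, Complex.exp_add, phase]
    ring
  set C := ‖(2 / √(2 * Real.pi) : ℂ)‖ with hC
  have hbd : ∀ t x, 0 < σ * t → 0 < x → ‖(2 / √(2 * Real.pi) : ℂ) * ∫ k in Ioi (0 : ℝ),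
        φ k * Complex.exp ((-(σ * (x * k + (σ * t) * α * k ^ 2)) : ℝ) * Complex.I)‖
        ≤ C * (D / (x + a * (σ * t * α))) := by
    intro t x ht hx
    rw [norm_mul]
    exact mul_le_mul_of_nonneg_left (H σ hσ _ (mul_pos ht hα) x hx) (norm_nonneg _)
  have hG : Integrable (fun x => (C * D) ^ 2 * (x + a * α) ^ (-2 : ℝ))
      (volume.restrict (Ioi (0 : ℝ))) :=
    (integrableOn_add_rpow_Ioi_of_lt (by norm_num) (by linarith [mul_pos ha hα])).const_mul _
  have h0 := Lp.coeFn_zero ℂ 2 (volume.restrict (Ioi (0 : ℝ)))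
  refine tendsto_L2_of_dominated hG hform ?_ ?_
  · filter_upwards [hl.eventually_ge_atTop 1] with t ht
    filter_upwards [h0, ae_restrict_mem measurableSet_Ioi] with x hx hx0
    have hx0 : 0 < x := hx0
    rw [hx, Pi.zero_apply, sub_zero]
    have h1 : 0 < x + a * α := by positivity
    have hle : x + a * α ≤ x + a * (σ * t * α) := by
      have : a * α * 1 ≤ a * α * (σ * t) := by gcongr
      linarith
    have hD : 0 ≤ D := by
      have := (norm_nonneg _).trans (H σ hσ 1 one_pos x hx0)
      rw [le_div_iff₀ (by positivity), zero_mul] at this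
      exact this
    calc _ ≤ (C * (D / (x + a * (σ * t * α)))) ^ 2 := by
          gcongr
          exact hbd t x (by linarith) hx0
      _ ≤ (C * (D / (x + a * α))) ^ 2 := by gcongr
      _ = (C * D) ^ 2 * (x + a * α) ^ (-2 : ℝ) := by
          rw [Real.rpow_neg h1.le, Real.rpow_two]
          field_simp
  · filter_upwards [h0, ae_restrict_mem measurableSet_Ioi] with x hx hx0
    rw [hx, Pi.zero_apply]
    have h1 : Tendsto (fun t => C * (D / (x + a * (σ * t * α)))) l (𝓝 0) := by
      have h2 : Tendsto (fun t => x + a * (σ * t * α)) l atTop :=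
        tendsto_atTop_add_const_left _ _ ((hl.atTop_mul_const hα).const_mul_atTop ha)
      simpa using (h2.const_div_atTop D).const_mul C
    refine squeeze_zero_norm' ?_ h1
    filter_upwards [hl.eventually_gt_atTop 0] with t ht
    exact hbd t x ht hx0

theorem tendsto_cosineTransform_add_smul_sineTransform {α σ : ℝ} (hα : 0 < α) (hσ : |σ| = 1)
    {l : Filter ℝ} [l.IsCountablyGenerated] (hl : Tendsto (fun t => σ * t) l atTop) (g : L2) :
    Tendsto (fun t => cosineTransform (phaseMul α t g) + (σ : ℂ) • sineTransform (phaseMul α t g))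
      l (𝓝 0) := by
  rw [Metric.tendsto_nhds]
  intro ε hε
  obtain ⟨f, hf, hfg⟩ := Metric.dense_iff.1 dense_testFunctions g (ε / 4) (by positivity)
  obtain ⟨φ, hφ, rfl⟩ := hfg
  filter_upwards [Metric.tendsto_nhds.1 (hφ.tendsto_zero hα hσ hl) (ε / 2) (by positivity)]
    with t ht
  rw [dist_zero_right] at ht ⊢
  set f := hφ.memLp.toLp with hfdef
  have hnorm : ∀ h : L2, ‖cosineTransform (phaseMul α t h) +
      (σ : ℂ) • sineTransform (phaseMul α t h)‖ ≤ 2 * ‖h‖ := by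
    intro h
    have hM : ‖phaseMul α t h‖ = ‖h‖ := norm_toLp_phase_mul α t h
    refine (norm_add_le _ _).trans ?_
    rw [norm_smul, norm_cosineTransform, norm_sineTransform, Complex.norm_real, Real.norm_eq_abs,
      hσ, hM]
    linarith
  have h1 := hnorm (g - f)
  have h2 : ‖g - f‖ < ε / 4 := by rwa [mem_ball_iff_norm'] at hf
  simp only [map_sub, smul_sub] at h1
  calc _ = ‖(cosineTransform (phaseMul α t f) + (σ : ℂ) • sineTransform (phaseMul α t f)) +
        (cosineTransform (phaseMul α t g) - cosineTransform (phaseMul α t f) +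
        ((σ : ℂ) • sineTransform (phaseMul α t g) - (σ : ℂ) • sineTransform (phaseMul α t f)))‖ := by
        congr 1; abel
    _ < ε := (norm_add_le _ _).trans_lt (by linarith)

/-! ### The wave operators -/

theorem isUnitaryGroupOf_dirichlet {hbar m : ℝ} (hh : 0 < hbar) (hm : 0 < m) :
    IsUnitaryGroupOf hbar (dirichletHamiltonian hbar m)
      fun t => star sineTransform * phaseMul (hbar / (2 * m)) t * sineTransform := by
  have hc : hbar * (hbar / (2 * m)) = hbar ^ 2 / (2 * m) := by ring
  refine isUnitaryGroupOf_of_diagonal hh (by positivity) sineTransform_mem_unitary ?_ ?_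
  · intro ψ χ h
    rw [graph_dirichletHamiltonian] at h
    rw [hc]
    exact sineTransform_of_mem_dirichletGraph h
  · intro h
    rw [graph_dirichletHamiltonian, hc]
    exact exists_dirichlet_solution hh hm h

theorem isUnitaryGroupOf_neumann {hbar m : ℝ} (hh : 0 < hbar) (hm : 0 < m) :
    IsUnitaryGroupOf hbar (neumannHamiltonian hbar m)
      fun t => star cosineTransform * phaseMul (hbar / (2 * m)) t * cosineTransform := by
  have hc : hbar * (hbar / (2 * m)) = hbar ^ 2 / (2 * m) := by ring
  refine isUnitaryGroupOf_of_diagonal hh (by positivity) cosineTransform_mem_unitary ?_ ?_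
  · intro ψ χ h
    rw [graph_neumannHamiltonian] at h
    rw [hc]
    exact cosineTransform_of_mem_neumannGraph h
  · intro h
    rw [graph_neumannHamiltonian, hc]
    exact exists_neumann_solution hh hm h

/-- The strong limits, for the two groups in diagonal form; `σ = ±1` is the sign of the time. -/
theorem isStrongLimit_diagonal {α σ : ℝ} (hα : 0 < α) (hσ : |σ| = 1) {l : Filter ℝ}
    [l.IsCountablyGenerated] (hl : Tendsto (fun t => σ * t) l atTop) :
    IsStrongLimit (fun t => (star cosineTransform * phaseMul α (-t) * cosineTransform) ∘L
      (star sineTransform * phaseMul α t * sineTransform)) l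
      ((σ : ℂ) • (ContinuousLinearMap.adjoint cosineTransform ∘L sineTransform)) := by
  intro ψ
  have hc : star cosineTransform = cosineTransform := adjoint_cosineTransform
  have hs : star sineTransform = -sineTransform := adjoint_sineTransform
  have hσ2 : (σ : ℂ) * σ = 1 := by
    rw [← Complex.ofReal_mul, ← abs_mul_abs_self, hσ]; simp
  set g := sineTransform ψ with hg
  rw [tendsto_iff_norm_sub_tendsto_zero]
  have h1 := (tendsto_cosineTransform_add_smul_sineTransform hα hσ hl g).norm
  rw [norm_zero] at h1
  refine h1.congr fun t => ?_
  set h := phaseMul α t g with hh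
  have e1 : g = phaseMul α (-t) h := by
    rw [hh, ← mul_apply_L2, ← phaseMul_add, neg_add_cancel, phaseMul_zero]; rfl
  have e2 : h = cosineTransform (cosineTransform h) := by
    have := apply_star_apply cosineTransform_mem_unitary h
    rw [hc] at this
    exact this.symm
  have hM : ∀ f, ‖phaseMul α (-t) f‖ = ‖f‖ := norm_toLp_phase_mul α (-t)
  have e3 : ((star cosineTransform * phaseMul α (-t) * cosineTransform) ∘L
      (star sineTransform * phaseMul α t * sineTransform)) ψ
      - ((σ : ℂ) • (ContinuousLinearMap.adjoint cosineTransform ∘L sineTransform)) ψ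
      = cosineTransform (phaseMul α (-t) (cosineTransform
        (-(σ : ℂ) • (cosineTransform h + (σ : ℂ) • sineTransform h)))) := by
    have l1 : ((star cosineTransform * phaseMul α (-t) * cosineTransform) ∘L
      (star sineTransform * phaseMul α t * sineTransform)) ψ
      = cosineTransform (phaseMul α (-t) (cosineTransform (-sineTransform h))) := by
      rw [hc, hs]; rfl
    have l2 : ((σ : ℂ) • (ContinuousLinearMap.adjoint cosineTransform ∘L sineTransform)) ψ
      = (σ : ℂ) • cosineTransform (phaseMul α (-t) (cosineTransform (cosineTransform h))) := by
      rw [adjoint_cosineTransform, ← e2, ← e1]; rfl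
    rw [l1, l2, ← map_smul, ← map_smul, ← map_smul, ← map_sub, ← map_sub, ← map_sub, smul_add,
      smul_smul, neg_mul, hσ2, neg_smul, neg_smul, one_smul]
    congr 3
    abel
  rw [e3, norm_cosineTransform, hM, norm_cosineTransform, norm_smul, norm_neg, Complex.norm_real,
    Real.norm_eq_abs, hσ, one_mul]

end HalfLine

end

theorem propositionA1 (hbar m : ℝ) (hhbar : 0 < hbar) (hm : 0 < m) :
    (∃ UD : ℝ → (HalfLine.L2 →L[ℂ] HalfLine.L2),
      HalfLine.IsUnitaryGroupOf hbar (HalfLine.dirichletHamiltonian hbar m) UD) ∧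
    (∃ UN : ℝ → (HalfLine.L2 →L[ℂ] HalfLine.L2),
      HalfLine.IsUnitaryGroupOf hbar (HalfLine.neumannHamiltonian hbar m) UN) ∧
    ∀ UD UN : ℝ → (HalfLine.L2 →L[ℂ] HalfLine.L2),
      HalfLine.IsUnitaryGroupOf hbar (HalfLine.dirichletHamiltonian hbar m) UD →
      HalfLine.IsUnitaryGroupOf hbar (HalfLine.neumannHamiltonian hbar m) UN →
      HalfLine.IsStrongLimit (fun t => UN (-t) ∘L UD t) atTop
        (ContinuousLinearMap.adjoint HalfLine.cosineTransform ∘L HalfLine.sineTransform) ∧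
      HalfLine.IsStrongLimit (fun t => UN (-t) ∘L UD t) atBot
        (-(ContinuousLinearMap.adjoint HalfLine.cosineTransform ∘L HalfLine.sineTransform)) := by
  refine ⟨⟨_, HalfLine.isUnitaryGroupOf_dirichlet hhbar hm⟩,
    ⟨_, HalfLine.isUnitaryGroupOf_neumann hhbar hm⟩, fun UD UN hD hN => ?_⟩
  obtain rfl := hD.unique (HalfLine.isUnitaryGroupOf_dirichlet hhbar hm) (by
    rintro _ ⟨φ, hφ, rfl⟩
    rw [HalfLine.graph_dirichletHamiltonian]
    exact hφ.mem_dirichletGraph hbar m)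
  obtain rfl := hN.unique (HalfLine.isUnitaryGroupOf_neumann hhbar hm) (by
    rintro _ ⟨φ, hφ, rfl⟩
    rw [HalfLine.graph_neumannHamiltonian]
    exact hφ.mem_neumannGraph hbar m)
  have hα : 0 < hbar / (2 * m) := by positivity
  constructor
  · have := HalfLine.isStrongLimit_diagonal (l := atTop) (σ := 1) hα (by simp)
      (by simpa using! tendsto_id)
    rwa [Complex.ofReal_one, one_smul] at this
  · have := HalfLine.isStrongLimit_diagonal (l := atBot) (σ := -1) hα (by simp)
      (by simpa using tendsto_neg_atBot_atTop)
    rwa [Complex.ofReal_neg, Complex.ofReal_one, neg_one_smul] at this
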